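/- Let $f:\mathbb R^d\to\mathbb R$ be convex and differentiable with $L$-Lipschitz gradient ($L>0$), let $g:\mathbb R^d\to(-\infty,\infty]$ be proper, lower semicontinuous and convex, and let $F=f+g$, with minimum value $F_*$ and nonempty set of minimizers $\Omega_*$. For $\eta>0$ and a function $h$ put $P_{\eta h}(x)=\arg\min_u \frac12\|u-x\|_2^2+\eta h(u)$, and let $G(x)=L\,\bigl(x-P_{g/L}(x-\nabla f(x)/L)\bigr)$ be the proximal gradient. **Hypotheses.** Let $\theta\in(0,1]$, $\gamma>1$, $\epsilon>0$, $0<c_0\le c<\infty$, and let $x_0\in\mathbb R^d$, $\epsilon_0$ satisfy $F(x_0)-F_*\le\epsilon_0$. Assume the Hölderian error bound on the initial sublevel set: $\operatorname{dist}(x,\Omega_*)\le c\,(F(x)-F_*)^\theta$ whenever $F(x)-F_*\le\epsilon_0$. **Algorithm (adaAGC).** The inputs are $x_0,c_0,\gamma,\theta,\epsilon_0,L$, and not $c$. Put $c_e=c_0$, $\varepsilon_0=\|G(x_0)\|_2$ and $K=\max\bigl(0,\lceil\log_2(\varepsilon_0/\epsilon)\rceil\bigr)$, with $K=0$ if $\varepsilon_0=0$.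 For $k=1,\dots,K$, stage $k$ repeats the following cycle until it is completed. Let $$\delta_k=\begin{cases}\min\Bigl(\frac L{32},\ \frac{\varepsilon_{k-1}^{(1-2\theta)/(1-\theta)}}{16\,c_e^{1/(1-\theta)}\,2^{\theta/(1-\theta)}}\Bigr)&\theta\le\frac12,\\[2mm] \min\Bigl(\frac L{32},\ \frac1{32\,c_e^2\,\epsilon_0^{2\theta-1}}\Bigr)&\theta>\frac12,\end{cases}\qquad g_{\delta_k}(x)=g(x)+\tfrac{\delta_k}2\|x-x_{k-1}\|_2^2 .$$ Start with $A_0=0$ and $x^k_0=v_0=x_{k-1}$. For $t=0,1,2,\dots$ let $a_{t+1}$ be the positive root of $\frac{a^2}{A_t+a}=2\,\frac{1+\delta_kA_t}{L}$ and set $$A_{t+1}=A_t+a_{t+1},\qquad y_t=\tfrac{A_t}{A_{t+1}}x^k_t+\tfrac{a_{t+1}}{A_{t+1}}v_t,\qquad x^k_{t+1}=P_{g_{\delta_k}/L}\bigl(y_t-\nabla f(y_t)/L\bigr),$$ $$v_{t+1}=\arg\min_x\ \tfrac12\|x-x_{k-1}\|_2^2+\sum_{\tau=1}^{t+1}a_\tau\nabla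 f(x^k_\tau)^\top x+A_{t+1}g_{\delta_k}(x).$$ If $\|G(x^k_{t+1})\|_2\le\varepsilon_{k-1}/2$, put $x_k=x^k_{t+1}$, $\varepsilon_k=\varepsilon_{k-1}/2$; stage $k$ is completed. Otherwise, if $t=\Bigl\lceil\sqrt{\frac{2L}{\delta_k}}\log\frac{\sqrt{L(L+\delta_k)}}{\delta_k}\Bigr\rceil$, replace $c_e$ by $\gamma c_e$ and start a new cycle of stage $k$. Each pass through the loop over $t$ counts as one iteration. **Claim.** There is a constant $C>0$ depending only on $\theta$ and $\gamma$ such that, for all data as above, adaAGC completes its $K$ stages, its output satisfies $\|G(x_K)\|_2\le\epsilon$, and the total number $N$ of iterations (over all stages and cycles) satisfies the following. * If $\theta\in(0,\frac12]$, then with $p=\frac{1-2\theta}{1-\theta}$ $$N\le C\Bigl(\Lambda\,\sqrt L\,c^{\frac1{2(1-\theta)}}\max\bigl(\epsilon^{-p/2},\ \log(\varepsilon_0/\epsilon)\bigr)+K\Bigr),\qquad \Lambda=\bigl(1+\log_\gamma(c/c_0)\bigr)\log\bigl(2+L\,c^{1/(1-\theta)}\epsilon^{-p}\bigr),$$ where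 the logarithm $\log(\varepsilon_0/\epsilon)$ is read as $0$ if $\varepsilon_0=0$. * If $\theta\in(\frac12,1]$, then $$N\le C\Bigl(\Lambda\,\sqrt L\,c\,\epsilon_0^{\theta-1/2}+K\Bigr),\qquad \Lambda=\bigl(1+\log_\gamma(c/c_0)\bigr)\log^2\bigl(2+L\,c^2\epsilon_0^{2\theta-1}\bigr).$$ So, up to logarithmic factors and up to $O(1)$ iterations per stage, the complexity is $\sqrt L\,c^{1/(2(1-\theta))}\max(\epsilon^{-p/2},\log(\varepsilon_0/\epsilon))$, respectively $\sqrt L\,c\,\epsilon_0^{\theta-1/2}$. -/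

import Mathlib

noncomputable section

namespace AdaAGC

variable {d : ℕ}

/-! ### Extended-valued convex functions and the composite problem -/

/-- `g : ℝᵈ → (-∞, ∞]` is proper, lower semicontinuous and convex (its epigraph is convex). -/
structure IsProperConvexLsc (g : EuclideanSpace ℝ (Fin d) → EReal) : Prop where
  ne_bot : ∀ x, g x ≠ ⊥
  exists_ne_top : ∃ x, g x ≠ ⊤
  lsc : LowerSemicontinuous g
  convex_epigraph : Convex ℝ {p : EuclideanSpace ℝ (Fin d) × ℝ | g p.1 ≤ (p.2 : EReal)}

/-- `f : ℝᵈ → ℝ` is convex and differentiable, and its gradient is `L`-Lipschitz. -/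
structure IsConvexSmooth (f : EuclideanSpace ℝ (Fin d) → ℝ) (L : ℝ) : Prop where
  convex : ConvexOn ℝ Set.univ f
  differentiable : Differentiable ℝ f
  lipschitz_gradient : ∀ x y, ‖gradient f x - gradient f y‖ ≤ L * ‖x - y‖

/-- The composite objective `F = f + g`. -/
def objective (f : EuclideanSpace ℝ (Fin d) → ℝ) (g : EuclideanSpace ℝ (Fin d) → EReal)
    (x : EuclideanSpace ℝ (Fin d)) : EReal :=
  (f x : EReal) + g x

/-- The optimal value `F_*`. -/
def optValue (F : EuclideanSpace ℝ (Fin d) → EReal) : EReal := ⨅ x, F x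

/-- The optimal set `Ω_*`. -/
def optSet (F : EuclideanSpace ℝ (Fin d) → EReal) : Set (EuclideanSpace ℝ (Fin d)) :=
  {x | ∀ y, F x ≤ F y}

/-- The Hölderian error bound with exponent `θ` and constant `c` on the sublevel set
`{x | F x - F_* ≤ ξ}`. It is meant for functions whose optimal set is nonempty. -/
def HolderErrorBound (F : EuclideanSpace ℝ (Fin d) → EReal) (ξ θ c : ℝ) : Prop :=
  ∀ x, F x - optValue F ≤ (ξ : EReal) →
    Metric.infDist x (optSet F) ≤ c * (F x - optValue F).toReal ^ θ

/-! ### Proximal mapping and proximal gradient -/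

/-- A minimizer of `φ` (unique for the strongly convex functions to which this is applied). -/
def argmin (φ : EuclideanSpace ℝ (Fin d) → EReal) : EuclideanSpace ℝ (Fin d) :=
  Classical.epsilon fun u => ∀ w, φ u ≤ φ w

/-- The proximal mapping `P_{η h}(x) = argmin_u ½‖u - x‖² + η h(u)`. -/
def prox (η : ℝ) (h : EuclideanSpace ℝ (Fin d) → EReal) (x : EuclideanSpace ℝ (Fin d)) :
    EuclideanSpace ℝ (Fin d) :=
  argmin fun u => ((1 / 2 * ‖u - x‖ ^ 2 : ℝ) : EReal) + (η : EReal) * h u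

/-- The proximal gradient `G_η(x) = (x - P_{η g}(x - η ∇f(x))) / η`. -/
def proxGrad (f : EuclideanSpace ℝ (Fin d) → ℝ) (g : EuclideanSpace ℝ (Fin d) → EReal) (η : ℝ)
    (x : EuclideanSpace ℝ (Fin d)) : EuclideanSpace ℝ (Fin d) :=
  (1 / η) • (x - prox η g (x - η • gradient f x))

/-! ### The adaptive accelerated gradient converging method (adaAGC) -/

/-- The regularized nonsmooth part `g_δ(x) = g(x) + (δ/2) ‖x - z‖²`. -/
def regularized (g : EuclideanSpace ℝ (Fin d) → EReal) (δ : ℝ) (z x : EuclideanSpace ℝ (Fin d)) :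
    EReal :=
  g x + ((δ / 2 * ‖x - z‖ ^ 2 : ℝ) : EReal)

/-- The regularization parameter `δ_k`, as a function of the current tolerance `tol = ε_{k-1}`,
the current guess `ce` of the error bound constant, and the bound `ξ` on the initial gap. -/
def regParam (θ L ξ tol ce : ℝ) : ℝ :=
  if θ ≤ 1 / 2 then
    min (L / 32)
      (tol ^ ((1 - 2 * θ) / (1 - θ)) / (16 * ce ^ (1 / (1 - θ)) * 2 ^ (θ / (1 - θ))))
  else
    min (L / 32) (1 / (32 * ce ^ 2 * ξ ^ (2 * θ - 1)))

/-- The positive root `a` of `a² / (A + a) = 2 (1 + δ A) / L`. -/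
def adgWeight (L δ A : ℝ) : ℝ :=
  (1 + δ * A) / L + √(((1 + δ * A) / L) ^ 2 + 2 * ((1 + δ * A) / L) * A)

theorem eq_adgWeight_iff {L δ A a : ℝ} (hL : 0 < L) (hδ : 0 ≤ δ) (hA : 0 ≤ A) (ha : 0 < a) :
    a ^ 2 / (A + a) = 2 * ((1 + δ * A) / L) ↔ a = adgWeight L δ A := by
  unfold adgWeight
  have hb : 0 < (1 + δ * A) / L := by positivity
  set b := (1 + δ * A) / L
  have hs : 0 ≤ b ^ 2 + 2 * b * A := by positivity
  have h1 := Real.sq_sqrt hs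
  have h2 := Real.sqrt_nonneg (b ^ 2 + 2 * b * A)
  have h3 : b ≤ √(b ^ 2 + 2 * b * A) := Real.le_sqrt_of_sq_le (by nlinarith [mul_nonneg hb.le hA])
  set r := √(b ^ 2 + 2 * b * A)
  rw [div_eq_iff (by positivity)]
  constructor
  · intro h
    have h4 : (a - (b + r)) * (a + (r - b)) = 0 := by linear_combination h - h1
    rcases mul_eq_zero.1 h4 with h5 | h5
    · linarith
    · linarith
  · rintro rfl
    linear_combination h1

/-- The length `⌈√(2L/δ) log(√(L(L+δ))/δ)⌉` after which a cycle is given up. -/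
def cycleLength (L δ : ℝ) : ℕ := ⌈√(2 * L / δ) * Real.log (√(L * (L + δ)) / δ)⌉₊

/-- The memory of adaAGC between two inner iterations. -/
structure State (d : ℕ) where
  /-- the number `k - 1` of completed stages -/
  stage : ℕ
  /-- the output `x_{k-1}` of the last completed stage -/
  center : EuclideanSpace ℝ (Fin d)
  /-- the tolerance `ε_{k-1}` -/
  tol : ℝ
  /-- the current guess of the error bound constant -/
  ce : ℝ
  /-- the inner iteration counter `t` -/
  t : ℕ
  /-- the weight `A_t` -/
  A : ℝ
  /-- the iterate `x_t` -/
  x : EuclideanSpace ℝ (Fin d)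
  /-- the point `v_t` -/
  v : EuclideanSpace ℝ (Fin d)
  /-- the accumulated gradient `∑_{τ=1}^{t} a_τ ∇f(x_τ)` -/
  s : EuclideanSpace ℝ (Fin d)

/-- The state at the start of a cycle of the accelerated dual gradient method from `z`. -/
def startCycle (stage : ℕ) (z : EuclideanSpace ℝ (Fin d)) (tol ce : ℝ) : State d :=
  { stage := stage, center := z, tol := tol, ce := ce, t := 0, A := 0, x := z, v := z, s := 0 }

/-- One inner iteration of adaAGC: one update of the accelerated dual gradient method for
`f + g_δ`, followed by the two tests (the stage is complete; the cycle is given up, and a new one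
started with an increased guess `γ ce`). -/
def step (f : EuclideanSpace ℝ (Fin d) → ℝ) (g : EuclideanSpace ℝ (Fin d) → EReal)
    (L θ γ ξ : ℝ) (S : State d) : State d :=
  let δ := regParam θ L ξ S.tol S.ce
  let gδ := regularized g δ S.center
  let a := adgWeight L δ S.A
  let A' := S.A + a
  let y := (S.A / A') • S.x + (a / A') • S.v
  let x' := prox (1 / L) gδ (y - (1 / L) • gradient f y)
  let s' := S.s + a • gradient f x'
  let v' := argmin fun u =>
    ((1 / 2 * ‖u - S.center‖ ^ 2 + inner ℝ s' u : ℝ) : EReal) + (A' : EReal) * gδ u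
  if ‖proxGrad f g (1 / L) x'‖ ≤ S.tol / 2 then
    startCycle (S.stage + 1) x' (S.tol / 2) S.ce
  else if S.t = cycleLength L δ then
    startCycle S.stage S.center S.tol (γ * S.ce)
  else
    { S with t := S.t + 1, A := A', x := x', v := v', s := s' }

/-- The state of adaAGC after `n` inner iterations (summed over all stages and cycles), started at
`x₀` with the initial guess `c₀`. -/
def run (f : EuclideanSpace ℝ (Fin d) → ℝ) (g : EuclideanSpace ℝ (Fin d) → EReal)
    (L θ γ ξ c₀ : ℝ) (x₀ : EuclideanSpace ℝ (Fin d)) (n : ℕ) : State d :=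
  (step f g L θ γ ξ)^[n] (startCycle 0 x₀ ‖proxGrad f g (1 / L) x₀‖ c₀)

/-- The number of stages `K = ⌈log₂(‖G(x₀)‖/ε)⌉` (zero if this is negative). -/
def numStages (f : EuclideanSpace ℝ (Fin d) → ℝ) (g : EuclideanSpace ℝ (Fin d) → EReal)
    (L : ℝ) (x₀ : EuclideanSpace ℝ (Fin d)) (ε : ℝ) : ℕ :=
  ⌈Real.logb 2 (‖proxGrad f g (1 / L) x₀‖ / ε)⌉₊

end AdaAGC

end

/-!
Convexity reduces the complexity of adaAGC to three facts.

*Weights.* The accelerated dual gradient method keeps the estimate-sequence invariant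
`EstimateInvariant`, whose preservation rests on the cocoercivity of the gradient of `f`. Hence
`A F_δ(x) ≤ A F_δ(u) + ½‖u - z‖²` for all `u`, where `z` is the center of the stage. The weight `A`
grows quadratically, and geometrically with ratio about `1 + √(2δ/L)`, so that a full cycle ends
with `A ≥ L / (4 δ²)` (`div_le_geometric_cycleLength`).

*Error bound.* If `‖G(z)‖ ≤ τ`, the next proximal gradient iterate has distance `D` to the optimal
set with `D ≤ τ / L` or with a gap of at most `2 τ D` (`exists_near_of_norm_proxGrad_le`). The
Hölderian bound turns this into `dist(z) ≤ (2 / L + Q) τ` with `Q = errorFactor`, and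
`δ = min (L/32) (1/(16 Q))` makes `δ dist(z) ≤ τ / 8` once the guess `ce` is at least `c`. Then a
full cycle halves the proximal gradient (`EstimateInvariant.norm_proxGrad_le_of_large`). If even
`D ≤ τ / L`, eight iterations suffice whatever `ce` is
(`EstimateInvariant.norm_proxGrad_le_of_near`); such stages are called fast.

*Accounting.* Only cycles with `ce < c` are given up, hence at most `1 + log_γ (c / c₀)` of them
(`exists_run_stage`). A cycle takes `O(1 + √(LQ) log(2 + LQ))` iterations. If `LQ` is small at the
final accuracy, all stages are fast and none is given up. Otherwise the additive constant
in the cost of a cycle given up is dominated by the main term, and it remains to sum over the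
completed cycles. Over the stages, the factors `√(LQ)` form a geometric progression for `θ < 1/2`
and are constant for `θ = 1/2`. For `θ > 1/2` they are constant as well, but all stages
except logarithmically many are fast, because the error bound is of higher order than `τ`
(`le_div_of_rpow_lt`).
-/

namespace AdaAGC

open scoped InnerProductSpace

variable {d : ℕ}

/-! ### Smooth convex functions -/

section Smooth

variable {f : EuclideanSpace ℝ (Fin d) → ℝ} {L : ℝ}

theorem hasDerivAt_comp_segment (hf : Differentiable ℝ f) (x v : EuclideanSpace ℝ (Fin d))
    (t : ℝ) : HasDerivAt (fun t : ℝ => f (x + t • v)) ⟪gradient f (x + t • v), v⟫_ℝ t := by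
  have h1 : HasDerivAt (fun t : ℝ => x + t • v) v t := by
    simpa using ((hasDerivAt_id t).smul_const v).const_add x
  have h2 := (hf (x + t • v)).hasFDerivAt.comp_hasDerivAt t h1
  rw [inner_gradient_left]
  exact h2

theorem IsConvexSmooth.abs_sub_le (hf : IsConvexSmooth f L) (x u : EuclideanSpace ℝ (Fin d)) :
    |f u - f x - ⟪gradient f x, u - x⟫_ℝ| ≤ L / 2 * ‖u - x‖ ^ 2 := by
  set v := u - x with hv
  have key : ∀ t ∈ Set.Ioo (0 : ℝ) 1,
      |⟪gradient f (x + t • v), v⟫_ℝ - ⟪gradient f x, v⟫_ℝ| ≤ L * t * ‖v‖ ^ 2 := by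
    intro t ht
    rw [← inner_sub_left]
    refine (abs_real_inner_le_norm _ _).trans ?_
    have h1 := hf.lipschitz_gradient (x + t • v) x
    rw [add_sub_cancel_left, norm_smul, Real.norm_of_nonneg ht.1.le] at h1
    nlinarith [mul_le_mul_of_nonneg_right h1 (norm_nonneg v)]
  have hD : ∀ σ t : ℝ, HasDerivAt
      (fun t : ℝ => σ * (f (x + t • v) - t * ⟪gradient f x, v⟫_ℝ) - L / 2 * t ^ 2 * ‖v‖ ^ 2)
      (σ * (⟪gradient f (x + t • v), v⟫_ℝ - ⟪gradient f x, v⟫_ℝ) - L * t * ‖v‖ ^ 2) t := by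
    intro σ t
    have h1 := (((hasDerivAt_comp_segment hf.differentiable x v t).sub
      ((hasDerivAt_id t).mul_const ⟪gradient f x, v⟫_ℝ)).const_mul σ).sub
      ((((hasDerivAt_id t).pow 2).const_mul (L / 2)).mul_const (‖v‖ ^ 2))
    refine h1.congr_deriv ?_
    simp only [id_eq, Nat.cast_ofNat, Nat.add_one_sub_one, pow_one]
    ring
  have anti : ∀ σ : ℝ, |σ| = 1 →
      σ * (f u - ⟪gradient f x, v⟫_ℝ) - L / 2 * ‖v‖ ^ 2 ≤ σ * f x := by
    intro σ hσ
    have h := antitoneOn_of_deriv_nonpos (convex_Icc (0 : ℝ) 1)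
      (fun t _ => (hD σ t).continuousAt.continuousWithinAt)
      (fun t _ => (hD σ t).differentiableAt.differentiableWithinAt)
      (fun t ht => by
        rw [interior_Icc] at ht
        rw [(hD σ t).deriv, sub_nonpos]
        refine (le_abs_self _).trans ?_
        rw [abs_mul, hσ, one_mul]
        exact key t ht)
    have h2 := h (Set.left_mem_Icc.2 zero_le_one) (Set.right_mem_Icc.2 zero_le_one) zero_le_one
    simpa [hv] using h2
  have h1 := anti 1 (by simp)
  have h2 := anti (-1) (by simp)
  rw [abs_le]
  constructor <;> linarith

theorem IsConvexSmooth.le_quadratic (hf : IsConvexSmooth f L) (x u : EuclideanSpace ℝ (Fin d)) :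
    f u ≤ f x + ⟪gradient f x, u - x⟫_ℝ + L / 2 * ‖u - x‖ ^ 2 := by
  linarith [(abs_le.1 (hf.abs_sub_le x u)).2]

theorem le_of_forall_sub_mul_le {a b M : ℝ} (h : ∀ t : ℝ, 0 < t → t ≤ 1 → b - M * t ≤ a) :
    b ≤ a := by
  refine le_of_forall_pos_le_add fun e he => ?_
  have h1 := h (min 1 (e / (|M| + 1))) (by positivity) (min_le_left _ _)
  have h2 : M * min 1 (e / (|M| + 1)) ≤ e := by
    calc M * min 1 (e / (|M| + 1)) ≤ (|M| + 1) * (e / (|M| + 1)) := by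
          gcongr
          · linarith [le_abs_self M]
          · exact min_le_right _ _
      _ = e := by field_simp
  linarith

theorem IsConvexSmooth.gradient_inequality (hf : IsConvexSmooth f L)
    (x u : EuclideanSpace ℝ (Fin d)) : f x + ⟪gradient f x, u - x⟫_ℝ ≤ f u := by
  refine le_of_forall_sub_mul_le (M := L / 2 * ‖u - x‖ ^ 2) fun t ht ht1 => ?_
  have h1 := (abs_le.1 (hf.abs_sub_le x (x + t • (u - x)))).1
  have h2 := hf.convex.2 (Set.mem_univ x) (Set.mem_univ u) (sub_nonneg.2 ht1) ht.le (by ring)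
  rw [show (1 - t) • x + t • u = x + t • (u - x) by module] at h2
  simp only [add_sub_cancel_left, inner_smul_right, norm_smul, Real.norm_of_nonneg ht.le,
    smul_eq_mul] at h1 h2
  have h3 : t * (f x + ⟪gradient f x, u - x⟫_ℝ - L / 2 * ‖u - x‖ ^ 2 * t) ≤ t * f u := by
    nlinarith
  exact le_of_mul_le_mul_left h3 ht

/-- The gradient of a smooth convex function is cocoercive. -/
theorem IsConvexSmooth.cocoercive (hf : IsConvexSmooth f L) (hL : 0 < L)
    (x y : EuclideanSpace ℝ (Fin d)) :
    ‖gradient f x - gradient f y‖ ^ 2 / L ≤ ⟪gradient f x - gradient f y, x - y⟫_ℝ := by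
  have key : ∀ x y : EuclideanSpace ℝ (Fin d),
      f y + ⟪gradient f y, x - y⟫_ℝ + ‖gradient f x - gradient f y‖ ^ 2 / (2 * L) ≤ f x := by
    intro x y
    set e := gradient f x - gradient f y with he
    have h1 := hf.gradient_inequality y (x - (1 / L) • e)
    have h2 := hf.le_quadratic x (x - (1 / L) • e)
    rw [show x - (1 / L) • e - x = -((1 / L) • e) by abel, norm_neg, norm_smul,
      Real.norm_of_nonneg (by positivity), inner_neg_right, inner_smul_right] at h2
    rw [show x - (1 / L) • e - y = (x - y) - (1 / L) • e by abel, inner_sub_right,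
      inner_smul_right] at h1
    have h3 : ⟪gradient f x, e⟫_ℝ - ⟪gradient f y, e⟫_ℝ = ‖e‖ ^ 2 := by
      rw [← inner_sub_left, ← he, real_inner_self_eq_norm_sq]
    have h4 : L / 2 * (1 / L * ‖e‖) ^ 2 = ‖e‖ ^ 2 / (2 * L) := by field_simp
    have h5 : 1 / L * ⟪gradient f x, e⟫_ℝ - 1 / L * ⟪gradient f y, e⟫_ℝ
        = 2 * (‖e‖ ^ 2 / (2 * L)) := by
      rw [← mul_sub, h3]; field_simp
    linarith
  have h1 := key x y
  have h2 := key y x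
  rw [norm_sub_rev] at h2
  have h3 : ⟪gradient f x, y - x⟫_ℝ = -⟪gradient f x, x - y⟫_ℝ := by
    rw [← inner_neg_right, neg_sub]
  have h4 : ‖gradient f x - gradient f y‖ ^ 2 / L
    = 2 * (‖gradient f x - gradient f y‖ ^ 2 / (2 * L)) := by field_simp
  rw [inner_sub_left]
  linarith

end Smooth

/-! ### Subgradients of extended-valued convex functions -/

/-- `s` is a subgradient of `g` at `x`, a point of the effective domain. Both sides are stated for
real values, so that `u` ranges over the effective domain as well. -/
def IsSubgradient (g : EuclideanSpace ℝ (Fin d) → EReal) (x s : EuclideanSpace ℝ (Fin d)) : Prop :=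
  g x ≠ ⊤ ∧ ∀ u, g u ≠ ⊤ → (g x).toReal + ⟪s, u - x⟫_ℝ ≤ (g u).toReal

section Subgradient

variable {g : EuclideanSpace ℝ (Fin d) → EReal}

theorem IsProperConvexLsc.coe_toReal (hg : IsProperConvexLsc g) {x : EuclideanSpace ℝ (Fin d)}
    (hx : g x ≠ ⊤) : ((g x).toReal : EReal) = g x :=
  EReal.coe_toReal hx (hg.ne_bot x)

theorem IsProperConvexLsc.segment_le (hg : IsProperConvexLsc g) {x u : EuclideanSpace ℝ (Fin d)}
    (hx : g x ≠ ⊤) (hu : g u ≠ ⊤) {t : ℝ} (ht : 0 ≤ t) (ht1 : t ≤ 1) :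
    g (x + t • (u - x)) ≠ ⊤ ∧
      (g (x + t • (u - x))).toReal ≤ (1 - t) * (g x).toReal + t * (g u).toReal := by
  have h := hg.convex_epigraph (x := (x, (g x).toReal)) (y := (u, (g u).toReal))
    (by simp [hg.coe_toReal hx]) (by simp [hg.coe_toReal hu]) (sub_nonneg.2 ht1) ht (by ring)
  have h1 : g (x + t • (u - x)) ≤ (((1 - t) * (g x).toReal + t * (g u).toReal : ℝ) : EReal) := by
    have h2 : (1 - t) • x + t • u = x + t • (u - x) := by module
    simpa [h2] using h
  have h3 : g (x + t • (u - x)) ≠ ⊤ := ne_top_of_le_ne_top (EReal.coe_ne_top _) h1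
  refine ⟨h3, ?_⟩
  rw [← hg.coe_toReal h3] at h1
  exact EReal.coe_le_coe_iff.1 h1

/-- First-order optimality: at a minimizer of `h + g`, the negative of the gradient `p` of `h` is a
subgradient of `g`. Differentiability of `h` is used in the form of a quadratic upper bound. -/
theorem IsProperConvexLsc.isSubgradient_of_isMin (hg : IsProperConvexLsc g)
    {h : EuclideanSpace ℝ (Fin d) → ℝ} {x p : EuclideanSpace ℝ (Fin d)} {M : ℝ} (hx : g x ≠ ⊤)
    (hq : ∀ u, h u ≤ h x + ⟪p, u - x⟫_ℝ + M * ‖u - x‖ ^ 2)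
    (hmin : ∀ u, g u ≠ ⊤ → h x + (g x).toReal ≤ h u + (g u).toReal) :
    IsSubgradient g x (-p) := by
  refine ⟨hx, fun u hu => ?_⟩
  refine le_of_forall_sub_mul_le (M := M * ‖u - x‖ ^ 2) fun t ht ht1 => ?_
  obtain ⟨h1, h2⟩ := hg.segment_le hx hu ht.le ht1
  have h3 := hmin _ h1
  have h4 := hq (x + t • (u - x))
  rw [add_sub_cancel_left, inner_smul_right, norm_smul, Real.norm_of_nonneg ht.le] at h4
  rw [inner_neg_left]
  have h5 : t * ((g x).toReal + -⟪p, u - x⟫_ℝ - M * ‖u - x‖ ^ 2 * t) ≤ t * (g u).toReal := by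
    nlinarith
  exact le_of_mul_le_mul_left h5 ht

end Subgradient

/-! ### Existence and characterization of the minimizers -/

theorem argmin_le_of_quadratic_le {φ : EuclideanSpace ℝ (Fin d) → EReal}
    (hφ : LowerSemicontinuous φ) {w x₀ : EuclideanSpace ℝ (Fin d)} {C m : ℝ}
    (hx₀ : φ x₀ = (m : EReal))
    (h : ∀ u, ((1 / 2 * ‖u - w‖ ^ 2 - C : ℝ) : EReal) ≤ φ u) (u : EuclideanSpace ℝ (Fin d)) :
    φ (argmin φ) ≤ φ u := by
  have hx₀' : 1 / 2 * ‖x₀ - w‖ ^ 2 - C ≤ m := by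
    have := h x₀
    rw [hx₀] at this
    exact EReal.coe_le_coe_iff.1 this
  have hmem : x₀ ∈ Metric.closedBall w √(2 * (C + m)) := by
    rw [mem_closedBall_iff_norm]
    exact Real.le_sqrt_of_sq_le (by linarith)
  obtain ⟨a, -, hamin⟩ := LowerSemicontinuousOn.exists_isMinOn ⟨x₀, hmem⟩
    (isCompact_closedBall w √(2 * (C + m))) (hφ.lowerSemicontinuousOn _)
  refine Classical.epsilon_spec (p := fun a => ∀ w, φ a ≤ φ w) ⟨a, fun u => ?_⟩ u
  by_cases hu : u ∈ Metric.closedBall w √(2 * (C + m))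
  · exact hamin hu
  · refine le_trans (hamin hmem) (le_trans ?_ (h u))
    rw [hx₀, EReal.coe_le_coe_iff]
    rw [mem_closedBall_iff_norm, not_le] at hu
    have := Real.lt_sq_of_sqrt_lt hu
    linarith

section Minimizer

variable {g : EuclideanSpace ℝ (Fin d) → EReal}

theorem regularized_zero (z : EuclideanSpace ℝ (Fin d)) : regularized g 0 z = g := by
  funext u
  simp [regularized]

/-- Value on the effective domain of the functions which the two subproblems minimize. -/
theorem subproblem_eq_coe (hg : IsProperConvexLsc g) (η δ : ℝ) (z u : EuclideanSpace ℝ (Fin d))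
    (a : ℝ) (hu : g u ≠ ⊤) :
    (a : EReal) + (η : EReal) * regularized g δ z u
      = ((a + η * ((g u).toReal + δ / 2 * ‖u - z‖ ^ 2) : ℝ) : EReal) := by
  unfold regularized
  rw [← hg.coe_toReal hu]
  push_cast
  simp

theorem subproblem_eq_top {η : ℝ} (hη : 0 < η) (δ : ℝ) (z u : EuclideanSpace ℝ (Fin d))
    (a : ℝ) (hu : g u = ⊤) :
    (a : EReal) + (η : EReal) * regularized g δ z u = ⊤ := by
  unfold regularized
  rw [hu, EReal.top_add_coe, EReal.coe_mul_top_of_pos hη, EReal.coe_add_top]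

theorem lowerSemicontinuous_subproblem (hg : IsProperConvexLsc g) {η : ℝ} (hη : 0 < η) (δ : ℝ)
    (z : EuclideanSpace ℝ (Fin d)) {a : EuclideanSpace ℝ (Fin d) → ℝ} (ha : Continuous a) :
    LowerSemicontinuous fun u => (a u : EReal) + (η : EReal) * regularized g δ z u := by
  have h1 : LowerSemicontinuous (regularized g δ z) := by
    refine hg.lsc.add'
      (continuous_coe_real_ereal.comp (by fun_prop)).lowerSemicontinuous fun u => ?_
    exact EReal.continuousAt_add (.inr (EReal.coe_ne_bot _)) (.inr (EReal.coe_ne_top _))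
  have h2 : Continuous fun x : EReal => (η : EReal) * x := by
    rw [continuous_iff_continuousAt]
    intro x
    have h3 : ContinuousAt (fun p : EReal × EReal => p.1 * p.2) ((η : EReal), x) :=
      EReal.continuousAt_mul (.inl (EReal.coe_ne_zero.2 hη.ne')) (.inl (EReal.coe_ne_zero.2 hη.ne'))
        (.inl (EReal.coe_ne_bot _)) (.inl (EReal.coe_ne_top _))
    exact h3.comp (f := fun x : EReal => ((η : EReal), x)) (by fun_prop)
  have h4 : LowerSemicontinuous fun u => (η : EReal) * regularized g δ z u :=
    h2.comp_lowerSemicontinuous h1 fun a b hab =>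
      mul_le_mul_of_nonneg_left hab (by exact_mod_cast hη.le)
  refine LowerSemicontinuous.add'
    (continuous_coe_real_ereal.comp (by fun_prop)).lowerSemicontinuous h4 fun u => ?_
  exact EReal.continuousAt_add (.inl (EReal.coe_ne_top _)) (.inl (EReal.coe_ne_bot _))

/-- The minimizer of `½‖u - w‖² + ⟪s, u⟫ + η (g(u) + δ/2 ‖u - z‖²)` exists, and its optimality
condition exhibits a subgradient of `g`. An affine minorant of `g`, here a subgradient at some
point, makes the problem coercive. -/
theorem isSubgradient_argmin (hg : IsProperConvexLsc g) (hsub : ∃ x p, IsSubgradient g x p)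
    {η δ : ℝ} (hη : 0 < η) (hδ : 0 ≤ δ) (w s z : EuclideanSpace ℝ (Fin d))
    {x : EuclideanSpace ℝ (Fin d)}
    (hx : x = argmin fun u => ((1 / 2 * ‖u - w‖ ^ 2 + ⟪s, u⟫_ℝ : ℝ) : EReal)
      + (η : EReal) * regularized g δ z u) :
    IsSubgradient g x (-((1 / η) • (x - w + s) + δ • (x - z))) := by
  obtain ⟨x₀, p, hx₀, hp⟩ := hsub
  set φ : EuclideanSpace ℝ (Fin d) → EReal := fun u =>
    ((1 / 2 * ‖u - w‖ ^ 2 + ⟪s, u⟫_ℝ : ℝ) : EReal) + (η : EReal) * regularized g δ z u with hφ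
  have hval : ∀ u, g u ≠ ⊤ → φ u = ((1 / 2 * ‖u - w‖ ^ 2 + ⟪s, u⟫_ℝ
      + η * ((g u).toReal + δ / 2 * ‖u - z‖ ^ 2) : ℝ) : EReal) :=
    fun u hu => subproblem_eq_coe hg η δ z u _ hu
  have hlsc : LowerSemicontinuous φ := lowerSemicontinuous_subproblem hg hη δ z (by fun_prop)
  set q := s + η • p with hq
  set C : ℝ := 1 / 2 * ‖w - q‖ ^ 2 - 1 / 2 * ‖w‖ ^ 2 - η * ((g x₀).toReal - ⟪p, x₀⟫_ℝ) with hC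
  have hmin : ∀ u, φ x ≤ φ u := by
    rw [hx]
    refine argmin_le_of_quadratic_le hlsc (w := w - q) (C := C) (hval x₀ hx₀) fun u => ?_
    by_cases hu : g u = ⊤
    · simp only [hφ, subproblem_eq_top hη δ z u _ hu]
      exact le_top
    · rw [hval u hu, EReal.coe_le_coe_iff]
      have h1 := mul_le_mul_of_nonneg_left (hp u hu) hη.le
      have h2 : 0 ≤ η * (δ / 2 * ‖u - z‖ ^ 2) := by positivity
      have h3 : ‖u - (w - q)‖ ^ 2 = ‖u‖ ^ 2 - 2 * (⟪w, u⟫_ℝ - ⟪q, u⟫_ℝ) + ‖w - q‖ ^ 2 := by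
        rw [norm_sub_sq_real, real_inner_comm, inner_sub_left]
      have h4 : ‖u - w‖ ^ 2 = ‖u‖ ^ 2 - 2 * ⟪w, u⟫_ℝ + ‖w‖ ^ 2 := by
        rw [norm_sub_sq_real, real_inner_comm]
      have h5 : ⟪q, u⟫_ℝ = ⟪s, u⟫_ℝ + η * ⟪p, u⟫_ℝ := by
        rw [hq, inner_add_left, real_inner_smul_left]
      rw [inner_sub_right] at h1
      rw [hC, h3, h4, h5]
      linarith
  have hxt : g x ≠ ⊤ := by
    intro hxt
    have h1 := hmin x₀
    rw [hval x₀ hx₀] at h1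
    simp only [hφ, subproblem_eq_top hη δ z x _ hxt, top_le_iff] at h1
    exact EReal.coe_ne_top _ h1
  have h := hg.isSubgradient_of_isMin (x := x) (p := (1 / η) • (x - w + s) + δ • (x - z))
    (M := 1 / (2 * η) + δ / 2)
    (h := fun u => 1 / η * (1 / 2 * ‖u - w‖ ^ 2 + ⟪s, u⟫_ℝ) + δ / 2 * ‖u - z‖ ^ 2) hxt ?_ ?_
  · exact h
  · intro u
    have h1 : ‖u - w‖ ^ 2 = ‖u - x‖ ^ 2 + 2 * ⟪x - w, u - x⟫_ℝ + ‖x - w‖ ^ 2 := by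
      rw [show u - w = (u - x) + (x - w) by abel, norm_add_sq_real, real_inner_comm]
    have h2 : ‖u - z‖ ^ 2 = ‖u - x‖ ^ 2 + 2 * ⟪x - z, u - x⟫_ℝ + ‖x - z‖ ^ 2 := by
      rw [show u - z = (u - x) + (x - z) by abel, norm_add_sq_real, real_inner_comm]
    have h3 : ⟪s, u⟫_ℝ = ⟪s, u - x⟫_ℝ + ⟪s, x⟫_ℝ := by
      rw [← inner_add_right, sub_add_cancel]
    simp only [inner_add_left, real_inner_smul_left]
    rw [h1, h2, h3]
    apply le_of_eq
    field_simp
    ring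
  · intro u hu
    have h1 := hmin u
    rw [hval u hu, hval x hxt, EReal.coe_le_coe_iff] at h1
    have h2 := mul_le_mul_of_nonneg_left h1 (one_div_pos.2 hη).le
    have h3 : ∀ a b : ℝ, 1 / η * (a + η * b) = 1 / η * a + b := fun a b => by field_simp
    rw [h3, h3] at h2
    linarith

end Minimizer

/-! ### The composite problem and its proximal gradient steps -/

/-- The data of the composite problem: `f` is convex and `L`-smooth with `L > 0`, `g` is proper,
lower semicontinuous and convex, and `f + g` has a minimizer. -/
structure IsComposite (f : EuclideanSpace ℝ (Fin d) → ℝ) (g : EuclideanSpace ℝ (Fin d) → EReal)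
    (L : ℝ) : Prop where
  pos : 0 < L
  smooth : IsConvexSmooth f L
  proper : IsProperConvexLsc g
  exists_min : (optSet (objective f g)).Nonempty

/-- The regularized objective `F(x) + δ/2 ‖x - z‖²` as a real number; it is meaningful on the
effective domain of `g`. -/
noncomputable def regObjective (f : EuclideanSpace ℝ (Fin d) → ℝ)
    (g : EuclideanSpace ℝ (Fin d) → EReal) (δ : ℝ) (z x : EuclideanSpace ℝ (Fin d)) : ℝ :=
  f x + (g x).toReal + δ / 2 * ‖x - z‖ ^ 2

/-- The proximal gradient step `x⁺ = P_{g/L}(x - ∇f(x)/L)`. -/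
noncomputable def proxStep (f : EuclideanSpace ℝ (Fin d) → ℝ)
    (g : EuclideanSpace ℝ (Fin d) → EReal) (L : ℝ) (x : EuclideanSpace ℝ (Fin d)) :
    EuclideanSpace ℝ (Fin d) :=
  prox (1 / L) g (x - (1 / L) • gradient f x)

section Composite

variable {f : EuclideanSpace ℝ (Fin d) → ℝ} {g : EuclideanSpace ℝ (Fin d) → EReal} {L δ : ℝ}
  {x y z u : EuclideanSpace ℝ (Fin d)}

theorem objective_ne_top_iff : objective f g x ≠ ⊤ ↔ g x ≠ ⊤ := by
  unfold objective
  rw [not_iff_not]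
  induction g x
  · rw [EReal.add_bot]
  · exact iff_of_false (by rw [← EReal.coe_add]; exact EReal.coe_ne_top _) (EReal.coe_ne_top _)
  · simp

theorem objective_eq_coe (hg : IsProperConvexLsc g) (hx : g x ≠ ⊤) (z : EuclideanSpace ℝ (Fin d)) :
    objective f g x = ((regObjective f g 0 z x : ℝ) : EReal) := by
  unfold objective regObjective
  rw [← hg.coe_toReal hx]
  simp

theorem IsComposite.ne_top_of_mem_optSet (h : IsComposite f g L) (hx : x ∈ optSet (objective f g)) :
    g x ≠ ⊤ := by
  obtain ⟨u, hu⟩ := h.proper.exists_ne_top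
  exact objective_ne_top_iff.1 (ne_top_of_le_ne_top (objective_ne_top_iff.2 hu) (hx u))

theorem IsComposite.le_of_mem_optSet (h : IsComposite f g L) (hx : x ∈ optSet (objective f g))
    (z : EuclideanSpace ℝ (Fin d)) (hu : g u ≠ ⊤) :
    regObjective f g 0 z x ≤ regObjective f g 0 z u := by
  have h1 := hx u
  rwa [objective_eq_coe h.proper (h.ne_top_of_mem_optSet hx) z, objective_eq_coe h.proper hu z,
    EReal.coe_le_coe_iff] at h1

theorem IsComposite.exists_subgradient (h : IsComposite f g L) :
    ∃ x p, IsSubgradient g x p := by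
  obtain ⟨x, hx⟩ := h.exists_min
  refine ⟨x, _, h.proper.isSubgradient_of_isMin (h.ne_top_of_mem_optSet hx)
    (h.smooth.le_quadratic x) fun u hu => ?_⟩
  simpa [regObjective] using h.le_of_mem_optSet hx x hu

theorem IsComposite.isSubgradient_prox (h : IsComposite f g L) (hδ : 0 ≤ δ)
    (hx : x = prox (1 / L) (regularized g δ z) (y - (1 / L) • gradient f y)) :
    IsSubgradient g x (L • (y - x) - gradient f y - δ • (x - z)) := by
  have hL := h.pos
  have h1 := isSubgradient_argmin h.proper h.exists_subgradient (one_div_pos.2 hL) hδ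
    (y - (1 / L) • gradient f y) 0 z (x := x) (by
      rw [hx]
      simp only [prox, inner_zero_left, add_zero])
  convert h1 using 1
  rw [one_div_one_div, show x - (y - (1 / L) • gradient f y) + 0
    = (1 / L) • gradient f y - (y - x) by abel, smul_sub L ((1 / L) • gradient f y), smul_smul,
    mul_one_div_cancel hL.ne']
  module

theorem IsComposite.isSubgradient_proxStep (h : IsComposite f g L)
    (x : EuclideanSpace ℝ (Fin d)) :
    IsSubgradient g (proxStep f g L x) (L • (x - proxStep f g L x) - gradient f x) := by
  have := h.isSubgradient_prox (δ := 0) (z := x) (y := x) le_rfl (x := proxStep f g L x)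
    (by rw [regularized_zero]; rfl)
  simpa using this

theorem IsComposite.norm_proxGrad (h : IsComposite f g L) (x : EuclideanSpace ℝ (Fin d)) :
    ‖proxGrad f g (1 / L) x‖ = L * ‖x - proxStep f g L x‖ := by
  rw [proxGrad, one_div_one_div, norm_smul, Real.norm_of_nonneg h.pos.le, proxStep]

/-- The fundamental inequality for a proximal gradient step from `y` to `x`, which the subgradient
`L (y - x) - ∇f(y) - δ (x - z)` of `g` at `x` describes. -/
theorem IsComposite.regObjective_step_le (h : IsComposite f g L)
    (hs : IsSubgradient g x (L • (y - x) - gradient f y - δ • (x - z))) (hu : g u ≠ ⊤) :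
    regObjective f g δ z x + L * ⟪y - x, u - x⟫_ℝ - L / 2 * ‖y - x‖ ^ 2 + δ / 2 * ‖u - x‖ ^ 2
      ≤ regObjective f g δ z u := by
  have h1 := hs.2 u hu
  have h2 := h.smooth.le_quadratic y x
  have h3 := h.smooth.gradient_inequality y u
  have h4 : ‖u - z‖ ^ 2 = ‖u - x‖ ^ 2 + 2 * ⟪x - z, u - x⟫_ℝ + ‖x - z‖ ^ 2 := by
    rw [show u - z = (u - x) + (x - z) by abel, norm_add_sq_real, real_inner_comm]
  have h5 : ⟪gradient f y, u - y⟫_ℝ = ⟪gradient f y, u - x⟫_ℝ + ⟪gradient f y, x - y⟫_ℝ := by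
    rw [← inner_add_right, sub_add_sub_cancel]
  rw [inner_sub_left, inner_sub_left, real_inner_smul_left, real_inner_smul_left] at h1
  rw [norm_sub_rev x y] at h2
  unfold regObjective
  rw [h4]
  linarith

theorem IsComposite.regObjective_proxStep_le (h : IsComposite f g L)
    (z : EuclideanSpace ℝ (Fin d)) (hu : g u ≠ ⊤) :
    regObjective f g 0 z (proxStep f g L x)
      + L * ⟪x - proxStep f g L x, u - proxStep f g L x⟫_ℝ
      - L / 2 * ‖x - proxStep f g L x‖ ^ 2 ≤ regObjective f g 0 z u := by
  have := h.regObjective_step_le (z := z) (δ := 0) (by simpa using h.isSubgradient_proxStep x) hu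
  simpa using this

/-- Sufficient decrease of the proximal gradient step. -/
theorem IsComposite.norm_proxGrad_sq_le (h : IsComposite f g L) (z : EuclideanSpace ℝ (Fin d))
    (hx : g x ≠ ⊤) :
    ‖proxGrad f g (1 / L) x‖ ^ 2
      ≤ 2 * L * (regObjective f g 0 z x - regObjective f g 0 z (proxStep f g L x)) := by
  have h1 := h.regObjective_proxStep_le z hx (x := x)
  rw [real_inner_self_eq_norm_sq] at h1
  rw [h.norm_proxGrad]
  nlinarith [h.pos]

end Composite

/-! ### The accelerated dual gradient method -/

section Accelerated

variable {f : EuclideanSpace ℝ (Fin d) → ℝ} {g : EuclideanSpace ℝ (Fin d) → EReal}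
  {L δ A : ℝ} {z x v s u : EuclideanSpace ℝ (Fin d)}

theorem adgWeight_pos (hL : 0 < L) (hδ : 0 ≤ δ) (hA : 0 ≤ A) : 0 < adgWeight L δ A := by
  have : 0 < (1 + δ * A) / L := by positivity
  unfold adgWeight
  positivity

theorem adgWeight_sq (hL : 0 < L) (hδ : 0 ≤ δ) (hA : 0 ≤ A) :
    adgWeight L δ A ^ 2 = 2 * ((1 + δ * A) / L) * (A + adgWeight L δ A) := by
  have ha := adgWeight_pos hL hδ hA
  rw [← div_eq_iff (by positivity)]
  exact (eq_adgWeight_iff hL hδ hA ha).2 rfl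

theorem adgWeight_zero (hL : 0 < L) : adgWeight L δ 0 = 2 / L := by
  unfold adgWeight
  rw [mul_zero, mul_zero, add_zero, add_zero, Real.sqrt_sq (by positivity)]
  ring

theorem sqrt_add_adgWeight_ge (hL : 0 < L) (hδ : 0 ≤ δ) (hA : 0 ≤ A) :
    √A + √((1 + δ * A) / (2 * L)) ≤ √(A + adgWeight L δ A) := by
  have ha := adgWeight_pos hL hδ hA
  have h1 := adgWeight_sq hL hδ hA
  set a := adgWeight L δ A
  set m := (1 + δ * A) / (2 * L) with hm
  have hm0 : 0 ≤ m := by positivity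
  have h2 : a ^ 2 = 4 * m * (A + a) := by rw [h1, hm]; field_simp; ring
  have h3 : a = 2 * √m * √(A + a) := by
    refine (pow_left_inj₀ ha.le (by positivity) two_ne_zero).1 ?_
    rw [mul_pow, mul_pow, Real.sq_sqrt hm0, Real.sq_sqrt (by positivity), h2]
    ring
  have h4 : 4 * m ≤ a := by
    by_contra! hlt
    nlinarith [mul_nonneg hm0 hA]
  have h5 : √m ≤ √(A + a) := Real.sqrt_le_sqrt (by linarith)
  have h6 : √A ≤ √(A + a) - √m := by
    refine Real.sqrt_le_iff.2 ⟨by linarith, ?_⟩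
    have := Real.sq_sqrt (show 0 ≤ A + a by positivity)
    have := Real.sq_sqrt hm0
    nlinarith
  linarith

/-- The estimate-sequence invariant of the accelerated dual gradient method: for a lower bound
`b + ⟪s, ·⟫` of `A f`, the estimate function
`ψ(u) = ½‖u - z‖² + b + ⟪s, u⟫ + A g_δ(u)` is at least `A F_δ(x) + (1 + A δ)/2 ‖u - v‖²`. -/
structure EstimateInvariant (f : EuclideanSpace ℝ (Fin d) → ℝ)
    (g : EuclideanSpace ℝ (Fin d) → EReal) (δ : ℝ) (z : EuclideanSpace ℝ (Fin d))
    (A : ℝ) (x v s : EuclideanSpace ℝ (Fin d)) : Prop where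
  nonneg : 0 ≤ A
  ne_top : g x ≠ ⊤
  exists_lower : ∃ b : ℝ, (∀ u, b + ⟪s, u⟫_ℝ ≤ A * f u) ∧
    ∀ u, g u ≠ ⊤ → A * regObjective f g δ z x + (1 + A * δ) / 2 * ‖u - v‖ ^ 2
      ≤ 1 / 2 * ‖u - z‖ ^ 2 + b + ⟪s, u⟫_ℝ + A * ((g u).toReal + δ / 2 * ‖u - z‖ ^ 2)

theorem EstimateInvariant.start (hz : g z ≠ ⊤) : EstimateInvariant f g δ z 0 z z 0 :=
  ⟨le_rfl, hz, 0, by simp, by simp⟩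

theorem EstimateInvariant.le (h : EstimateInvariant f g δ z A x v s) (hδ : 0 ≤ δ) (hu : g u ≠ ⊤) :
    A * regObjective f g δ z x ≤ 1 / 2 * ‖u - z‖ ^ 2 + A * regObjective f g δ z u := by
  obtain ⟨b, hb, hψ⟩ := h.exists_lower
  have h1 := hb u
  have h2 := hψ u hu
  have h3 : 0 ≤ (1 + A * δ) / 2 * ‖u - v‖ ^ 2 := by
    have := h.nonneg
    positivity
  unfold regObjective at *
  linarith

theorem EstimateInvariant.step (h : EstimateInvariant f g δ z A x v s) (hc : IsComposite f g L)
    (hδ : 0 ≤ δ) {a A' : ℝ} {y x' s' v' : EuclideanSpace ℝ (Fin d)}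
    (ha : a = adgWeight L δ A) (hA' : A' = A + a) (hy : y = (A / A') • x + (a / A') • v)
    (hx' : x' = prox (1 / L) (regularized g δ z) (y - (1 / L) • gradient f y))
    (hs' : s' = s + a • gradient f x')
    (hv' : v' = argmin fun u => ((1 / 2 * ‖u - z‖ ^ 2 + inner ℝ s' u : ℝ) : EReal)
      + (A' : EReal) * regularized g δ z u) :
    EstimateInvariant f g δ z A' x' v' s' := by
  have hL := hc.pos
  have hA := h.nonneg
  have hapos : 0 < a := ha ▸ adgWeight_pos hL hδ hA
  have hA'pos : 0 < A' := by linarith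
  have hsq : a ^ 2 = 2 * ((1 + δ * A) / L) * A' := by
    rw [hA', ha]; exact adgWeight_sq hL hδ hA
  obtain ⟨b, hb, hψ⟩ := h.exists_lower
  have hsub := hc.isSubgradient_prox hδ hx'
  have hsubv := isSubgradient_argmin hc.proper hc.exists_subgradient hA'pos hδ z s' z hv'
  -- the subgradient of the regularized objective at `x'`
  set ζ := L • (y - x') - gradient f y + gradient f x' with hζ
  have hsubδ : ∀ u, g u ≠ ⊤ → (g x').toReal + δ / 2 * ‖x' - z‖ ^ 2
      + ⟪ζ - gradient f x', u - x'⟫_ℝ ≤ (g u).toReal + δ / 2 * ‖u - z‖ ^ 2 := by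
    intro u hu
    have h1 := hsub.2 u hu
    have h2 : ‖u - z‖ ^ 2 = ‖u - x'‖ ^ 2 + 2 * ⟪x' - z, u - x'⟫_ℝ + ‖x' - z‖ ^ 2 := by
      rw [show u - z = (u - x') + (x' - z) by abel, norm_add_sq_real, real_inner_comm]
    have h3 : ⟪ζ - gradient f x', u - x'⟫_ℝ
        = ⟪L • (y - x') - gradient f y - δ • (x' - z), u - x'⟫_ℝ + δ * ⟪x' - z, u - x'⟫_ℝ := by
      rw [← real_inner_smul_left, ← inner_add_left, hζ]
      congr 1
      abel
    have h4 : 0 ≤ δ / 2 * ‖u - x'‖ ^ 2 := by positivity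
    rw [h3, h2]
    linarith
  -- cocoercivity gives `⟪ζ, y - x'⟫ ≥ ‖ζ‖² / L`
  have hcoc : ‖ζ‖ ^ 2 / L ≤ ⟪ζ, y - x'⟫_ℝ := by
    have h1 := hc.smooth.cocoercive hL y x'
    set e := gradient f y - gradient f x' with he
    have h2 : ζ = L • (y - x') - e := by rw [hζ, he]; abel
    have h3 : ‖ζ‖ ^ 2 / L = L * ‖y - x'‖ ^ 2 - 2 * ⟪e, y - x'⟫_ℝ + ‖e‖ ^ 2 / L := by
      rw [h2, norm_sub_sq_real, norm_smul, Real.norm_of_nonneg hL.le, real_inner_smul_left,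
        real_inner_comm]
      field_simp
    have h4 : ⟪ζ, y - x'⟫_ℝ = L * ‖y - x'‖ ^ 2 - ⟪e, y - x'⟫_ℝ := by
      rw [h2, inner_sub_left, real_inner_smul_left, real_inner_self_eq_norm_sq]
    rw [h3, h4]
    linarith
  -- every value of the new estimate function is at least `A' F_δ(x')`
  have hlow : ∀ u, g u ≠ ⊤ → A' * regObjective f g δ z x' ≤ 1 / 2 * ‖u - z‖ ^ 2
      + (b + a * (f x' - ⟪gradient f x', x'⟫_ℝ)) + ⟪s', u⟫_ℝ
      + A' * ((g u).toReal + δ / 2 * ‖u - z‖ ^ 2) := by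
    intro u hu
    have h1 := hψ u hu
    have h2 := mul_le_mul_of_nonneg_left (hsubδ u hu) hapos.le
    have h3 := mul_le_mul_of_nonneg_left (add_le_add (hsubδ x h.ne_top)
      (hc.smooth.gradient_inequality x' x)) hA
    have h4 : A' * ⟪ζ, y - x'⟫_ℝ + a * ⟪ζ, u - v⟫_ℝ
        = A * ⟪ζ, x - x'⟫_ℝ + a * ⟪ζ, u - x'⟫_ℝ := by
      have h5 : A' • y = A • x + a • v := by
        rw [hy, smul_add, smul_smul, smul_smul, mul_div_cancel₀ _ hA'pos.ne',
          mul_div_cancel₀ _ hA'pos.ne']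
      rw [← real_inner_smul_right, ← real_inner_smul_right, ← real_inner_smul_right,
        ← real_inner_smul_right, ← inner_add_right, ← inner_add_right]
      congr 1
      rw [smul_sub, h5, hA']
      module
    have h6 : 0 ≤ A' * (‖ζ‖ ^ 2 / L) + a * ⟪ζ, u - v⟫_ℝ + (1 + A * δ) / 2 * ‖u - v‖ ^ 2 := by
      have h7 : 0 ≤ ‖a • ζ + (1 + A * δ) • (u - v)‖ ^ 2 := by positivity
      rw [norm_add_sq_real, norm_smul, norm_smul, real_inner_smul_left, real_inner_smul_right,
        Real.norm_of_nonneg hapos.le, Real.norm_of_nonneg (by positivity), mul_pow, hsq] at h7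
      have h8 : A' * (‖ζ‖ ^ 2 / L) + a * ⟪ζ, u - v⟫_ℝ + (1 + A * δ) / 2 * ‖u - v‖ ^ 2
          = (2 * ((1 + δ * A) / L) * A' * ‖ζ‖ ^ 2 + 2 * (a * ((1 + A * δ) * ⟪ζ, u - v⟫_ℝ))
            + ((1 + A * δ) * ‖u - v‖) ^ 2) / (2 * (1 + A * δ)) := by
        field_simp
      rw [h8]
      positivity
    have h9 := mul_le_mul_of_nonneg_left hcoc hA'pos.le
    have h10 : ⟪s', u⟫_ℝ = ⟪s, u⟫_ℝ + a * ⟪gradient f x', u⟫_ℝ := by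
      rw [hs', inner_add_left, real_inner_smul_left]
    simp only [inner_sub_left, inner_sub_right] at h1 h2 h3 h4 h9 h6
    unfold regObjective at *
    rw [h10, hA'] at *
    linarith
  refine ⟨hA'pos.le, hsub.1, b + a * (f x' - ⟪gradient f x', x'⟫_ℝ), fun u => ?_, fun u hu => ?_⟩
  · have h1 := hb u
    have h2 := mul_le_mul_of_nonneg_left (hc.smooth.gradient_inequality x' u) hapos.le
    rw [hs', inner_add_left, real_inner_smul_left, hA']
    rw [inner_sub_right] at h2
    linarith
  · have h1 := hlow v' hsubv.1
    have h2 := mul_le_mul_of_nonneg_left (hsubv.2 u hu) hA'pos.le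
    rw [inner_neg_left, inner_add_left, real_inner_smul_left, real_inner_smul_left,
      inner_add_left] at h2
    have h3 : ‖u - z‖ ^ 2 = ‖u - v'‖ ^ 2 + 2 * ⟪v' - z, u - v'⟫_ℝ + ‖v' - z‖ ^ 2 := by
      rw [show u - z = (u - v') + (v' - z) by abel, norm_add_sq_real, real_inner_comm]
    have h4 : ⟪s', u⟫_ℝ = ⟪s', u - v'⟫_ℝ + ⟪s', v'⟫_ℝ := by
      rw [← inner_add_right, sub_add_cancel]
    have h5 : A' * (1 / A' * (⟪v' - z, u - v'⟫_ℝ + ⟪s', u - v'⟫_ℝ))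
        = ⟪v' - z, u - v'⟫_ℝ + ⟪s', u - v'⟫_ℝ := by field_simp
    rw [h3, h4]
    linarith

end Accelerated

/-! ### From large weights to a small proximal gradient -/

section StageGuarantee

variable {f : EuclideanSpace ℝ (Fin d) → ℝ} {g : EuclideanSpace ℝ (Fin d) → EReal}
  {L δ A τ r : ℝ} {z x v s p : EuclideanSpace ℝ (Fin d)}

theorem regObjective_eq_add (δ : ℝ) (z x : EuclideanSpace ℝ (Fin d)) :
    regObjective f g δ z x = regObjective f g 0 z x + δ / 2 * ‖x - z‖ ^ 2 := by
  simp [regObjective]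

theorem regObjective_zero_center (z z' x : EuclideanSpace ℝ (Fin d)) :
    regObjective f g 0 z x = regObjective f g 0 z' x := by
  simp [regObjective]

theorem EstimateInvariant.le_center (h : EstimateInvariant f g δ z A x v s) (hδ : 0 ≤ δ)
    (hA : 0 < A) (hz : g z ≠ ⊤) : regObjective f g 0 z x ≤ regObjective f g 0 z z := by
  have h1 := h.le hδ hz
  have h2 : 0 ≤ δ / 2 * ‖x - z‖ ^ 2 := by positivity
  rw [sub_self, norm_zero] at h1
  have h3 : regObjective f g δ z x ≤ regObjective f g δ z z :=
    le_of_mul_le_mul_left (by linarith) hA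
  rw [regObjective_eq_add, regObjective_eq_add δ z z, sub_self, norm_zero] at h3
  linarith

/-- If the center of the stage is within `2 τ / L` of the optimal set, a bounded number of
iterations halves the proximal gradient: the objective gap is small enough for the sufficient
decrease estimate to suffice. -/
theorem EstimateInvariant.norm_proxGrad_le_of_near (h : EstimateInvariant f g δ z A x v s)
    (hc : IsComposite f g L) (hδ : 0 ≤ δ) (hδL : δ ≤ L / 32) (hA : 32 / L ≤ A) (hτ : 0 ≤ τ)
    (hp : p ∈ optSet (objective f g)) (hr : ‖p - z‖ ≤ 2 * τ / L) :
    ‖proxGrad f g (1 / L) x‖ ≤ τ / 2 := by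
  have hL := hc.pos
  have hApos : 0 < A := lt_of_lt_of_le (by positivity) hA
  have h1 := hc.norm_proxGrad_sq_le z h.ne_top
  have h2 := hc.le_of_mem_optSet hp z (hc.isSubgradient_proxStep x).1
  have h3 := h.le hδ (hc.ne_top_of_mem_optSet hp)
  rw [regObjective_eq_add, regObjective_eq_add δ z p] at h3
  have h4 : 0 ≤ δ / 2 * ‖x - z‖ ^ 2 := by positivity
  have h5 : regObjective f g 0 z x - regObjective f g 0 z p
      ≤ (δ / 2 + 1 / (2 * A)) * ‖p - z‖ ^ 2 := by
    refine le_of_mul_le_mul_left ?_ hApos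
    have h6 : A * ((δ / 2 + 1 / (2 * A)) * ‖p - z‖ ^ 2)
        = A * (δ / 2 * ‖p - z‖ ^ 2) + 1 / 2 * ‖p - z‖ ^ 2 := by
      field_simp
    have h7 : 0 ≤ A * (δ / 2 * ‖x - z‖ ^ 2) := by positivity
    rw [h6]
    linarith
  have h6 : δ / 2 + 1 / (2 * A) ≤ L / 32 := by
    have h7 : 1 / (2 * A) ≤ L / 64 := by
      rw [div_le_iff₀ (by positivity)]
      rw [div_le_iff₀ hL] at hA
      linarith
    linarith
  have h7 : ‖p - z‖ ^ 2 ≤ (2 * τ / L) ^ 2 := by gcongr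
  have h8 : (δ / 2 + 1 / (2 * A)) * ‖p - z‖ ^ 2 ≤ L / 32 * (2 * τ / L) ^ 2 := by gcongr
  have h9 : 2 * L * (L / 32 * (2 * τ / L) ^ 2) = (τ / 2) ^ 2 := by field_simp; norm_num
  refine (pow_le_pow_iff_left₀ (norm_nonneg _) (by positivity) two_ne_zero).1 (h1.trans ?_)
  rw [← h9]
  gcongr
  linarith

/-- If `δ` times the distance of the center to the optimal set is at most `τ / 8`, the proximal
gradient is halved once the weight `A` has reached `L / (4 δ²)`. The iterate `x` is compared with
the proximal gradient step for the regularized objective, whose distance to the center is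
controlled by optimality in the regularized problem. -/
theorem EstimateInvariant.norm_proxGrad_le_of_large (h : EstimateInvariant f g δ z A x v s)
    (hc : IsComposite f g L) (hδ : 0 < δ) (hδL : δ ≤ L / 32) (hA : L / (4 * δ ^ 2) ≤ A)
    (hp : p ∈ optSet (objective f g)) (hr : δ * ‖p - z‖ ≤ τ / 8) :
    ‖proxGrad f g (1 / L) x‖ ≤ τ / 2 := by
  have hL := hc.pos
  have hApos : 0 < A := lt_of_lt_of_le (by positivity) hA
  obtain ⟨x', hx'⟩ : ∃ x', x' = prox (1 / L) (regularized g δ z) (x - (1 / L) • gradient f x) :=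
    ⟨_, rfl⟩
  have hs := hc.isSubgradient_prox hδ.le hx'
  have hs0 := hc.isSubgradient_proxStep x
  set w := ‖x' - z‖ with hw
  have hw0 : 0 ≤ w := norm_nonneg _
  have h1 := hc.regObjective_step_le hs h.ne_top
  rw [real_inner_self_eq_norm_sq] at h1
  have h1' : 0 ≤ δ / 2 * ‖x - x'‖ ^ 2 := by positivity
  have h1'' : 0 ≤ L / 2 * ‖x - x'‖ ^ 2 := by positivity
  have h2 := h.le hδ.le hs.1
  have h3 := h.le hδ.le (hc.ne_top_of_mem_optSet hp)
  have h4 := hc.le_of_mem_optSet hp z hs.1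
  have h5 : A * L * ‖x - x'‖ ^ 2 ≤ w ^ 2 := by
    have := mul_le_mul_of_nonneg_left h1 hApos.le
    have := mul_nonneg hApos.le h1'
    linarith
  have h6 : A * δ * w ^ 2 ≤ (1 + A * δ) * ‖p - z‖ ^ 2 := by
    have := mul_le_mul_of_nonneg_left h1 hApos.le
    have := mul_nonneg hApos.le h1'
    have := mul_nonneg hApos.le h1''
    have := mul_le_mul_of_nonneg_left h4 hApos.le
    rw [regObjective_eq_add δ z x'] at *
    rw [regObjective_eq_add δ z p] at *
    linarith
  have hAδ2 : L ≤ A * (4 * δ ^ 2) := (div_le_iff₀ (by positivity)).1 hA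
  have hAδ : 8 ≤ A * δ := by
    have : 8 * δ ≤ A * δ * δ := by linarith
    exact le_of_mul_le_mul_right this hδ
  -- the two proximal steps differ by at most `δ w / L`
  have h7 : L * ‖proxStep f g L x - x'‖ ≤ δ * w := by
    have h8 := hs.2 _ hs0.1
    have h9 := hs0.2 _ hs.1
    set x₁ := proxStep f g L x
    have h10 : L * ‖x₁ - x'‖ ^ 2 ≤ δ * ⟪x' - z, x₁ - x'⟫_ℝ := by
      have h11 : ⟪L • (x - x₁) - gradient f x, x' - x₁⟫_ℝ
          = -⟪L • (x - x₁) - gradient f x, x₁ - x'⟫_ℝ := by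
        rw [← inner_neg_right, neg_sub]
      have h12 : ⟪L • (x - x') - gradient f x - δ • (x' - z), x₁ - x'⟫_ℝ
          - ⟪L • (x - x₁) - gradient f x, x₁ - x'⟫_ℝ
          = L * ‖x₁ - x'‖ ^ 2 - δ * ⟪x' - z, x₁ - x'⟫_ℝ := by
        rw [← inner_sub_left, ← real_inner_self_eq_norm_sq, ← real_inner_smul_left,
          ← real_inner_smul_left, ← inner_sub_left]
        congr 1
        module
      linarith
    have h11 : L * ‖x₁ - x'‖ * ‖x₁ - x'‖ ≤ δ * w * ‖x₁ - x'‖ := by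
      have := mul_le_mul_of_nonneg_left (real_inner_le_norm (x' - z) (x₁ - x')) hδ.le
      nlinarith
    rcases (norm_nonneg (x₁ - x')).eq_or_lt with h0 | h0
    · rw [← h0, mul_zero]
      positivity
    · exact le_of_mul_le_mul_right h11 h0
  have h8 : L * ‖x - x'‖ ≤ 2 * δ * w := by
    refine (pow_le_pow_iff_left₀ (by positivity) (by positivity) two_ne_zero).1 ?_
    have h9 : L * (L * ‖x - x'‖ ^ 2) ≤ A * (4 * δ ^ 2) * (L * ‖x - x'‖ ^ 2) := by gcongr
    have h10 := mul_le_mul_of_nonneg_left h5 (show 0 ≤ 4 * δ ^ 2 by positivity)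
    nlinarith
  have h9 : δ * w ≤ τ / 6 := by
    have h10 : w ≤ 4 / 3 * ‖p - z‖ := by
      refine (pow_le_pow_iff_left₀ hw0 (by positivity) two_ne_zero).1 ?_
      refine le_of_mul_le_mul_left (h6.trans ?_) (show 0 < A * δ by positivity)
      nlinarith [sq_nonneg ‖p - z‖]
    nlinarith
  rw [hc.norm_proxGrad]
  have h10 : ‖x - proxStep f g L x‖ ≤ ‖x - x'‖ + ‖proxStep f g L x - x'‖ := by
    rw [norm_sub_rev (proxStep f g L x)]
    exact norm_sub_le_norm_sub_add_norm_sub _ _ _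
  have h11 := mul_le_mul_of_nonneg_left h10 hL.le
  linarith

end StageGuarantee

/-! ### The error bound in terms of the proximal gradient -/

/-- The factor `Q` for which the error bound gives `dist(x, Ω_*) ≤ (2/L + Q) τ` whenever
`‖G(x)‖ ≤ τ`; the regularization parameter is `min (L/32) (1/(16 Q))`. -/
noncomputable def errorFactor (θ ξ τ c : ℝ) : ℝ :=
  if θ ≤ 1 / 2 then c ^ (1 / (1 - θ)) * 2 ^ (θ / (1 - θ)) / τ ^ ((1 - 2 * θ) / (1 - θ))
  else 2 * c ^ 2 * ξ ^ (2 * θ - 1)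

theorem regParam_eq (θ L ξ τ c : ℝ) :
    regParam θ L ξ τ c = min (L / 32) (1 / (16 * errorFactor θ ξ τ c)) := by
  unfold regParam errorFactor
  split_ifs
  · rw [mul_div_assoc', one_div_div, mul_assoc]
  · congr 2
    ring

theorem errorFactor_pos {θ ξ τ c : ℝ} (hξ : 0 < ξ) (hτ : 0 < τ) (hc : 0 < c) :
    0 < errorFactor θ ξ τ c := by
  unfold errorFactor
  split_ifs <;> positivity

theorem errorFactor_mono {θ ξ τ c c' : ℝ} (hξ : 0 < ξ) (hτ : 0 < τ) (hc : 0 < c) (hcc : c ≤ c') :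
    errorFactor θ ξ τ c ≤ errorFactor θ ξ τ c' := by
  unfold errorFactor
  split_ifs with h
  · have h1 : 0 < 1 - θ := by linarith
    gcongr
  · gcongr

/-- The error bound at a point of gap `Δ ≤ 2 τ D`, solved for the distance `D`. For `θ > 1/2` it is
first weakened to the exponent `1/2` by means of `Δ ≤ ξ`. -/
theorem le_errorFactor_mul {θ ξ τ c D Δ : ℝ} (hθ0 : 0 < θ) (hξ : 0 < ξ) (hτ : 0 < τ) (hc : 0 < c)
    (hD : 0 ≤ D) (hΔ : 0 ≤ Δ) (hΔξ : Δ ≤ ξ) (hΔD : Δ ≤ 2 * τ * D) (h : D ≤ c * Δ ^ θ) :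
    D ≤ errorFactor θ ξ τ c * τ := by
  rcases hD.eq_or_lt with rfl | hD
  · exact mul_nonneg (errorFactor_pos hξ hτ hc).le hτ.le
  unfold errorFactor
  split_ifs with hθ
  · have hθ' : 0 < 1 - θ := by linarith
    have h1 : D ≤ c * ((2 * τ) ^ θ * D ^ θ) := by
      rw [← Real.mul_rpow (by positivity) hD.le]
      exact h.trans (by gcongr)
    have h2 : D ^ (1 - θ) ≤ c * (2 * τ) ^ θ := by
      rw [Real.rpow_sub hD, Real.rpow_one, div_le_iff₀ (by positivity), mul_assoc]
      exact h1
    have h3 : D ≤ (c * (2 * τ) ^ θ) ^ (1 / (1 - θ)) := by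
      calc D = (D ^ (1 - θ)) ^ (1 / (1 - θ)) := by
            rw [← Real.rpow_mul hD.le, mul_one_div_cancel hθ'.ne', Real.rpow_one]
        _ ≤ _ := by gcongr
    refine h3.trans (le_of_eq ?_)
    rw [Real.mul_rpow hc.le (by positivity), ← Real.rpow_mul (by positivity),
      Real.mul_rpow two_pos.le hτ.le, mul_one_div, div_mul_eq_mul_div, mul_div_assoc, ← mul_assoc]
    congr 1
    rw [eq_div_iff (by positivity), ← Real.rpow_add hτ]
    convert Real.rpow_one τ using 2
    field_simp
    ring
  · have hθ' : 0 ≤ θ - 1 / 2 := by linarith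
    have h1 : D ^ 2 ≤ c ^ 2 * (ξ ^ (2 * θ - 1) * (2 * τ * D)) := by
      have h2 : (Δ ^ θ) ^ 2 = Δ ^ (2 * θ - 1) * Δ := by
        rcases hΔ.eq_or_lt with rfl | hΔ
        · rw [Real.zero_rpow hθ0.ne']; ring
        · rw [← Real.rpow_natCast, ← Real.rpow_mul hΔ.le]
          nth_rewrite 3 [← Real.rpow_one Δ]
          rw [← Real.rpow_add hΔ]
          congr 1
          push_cast
          ring
      calc D ^ 2 ≤ (c * Δ ^ θ) ^ 2 := by gcongr
        _ = c ^ 2 * (Δ ^ (2 * θ - 1) * Δ) := by rw [mul_pow, h2]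
        _ ≤ _ := by
          have : 0 ≤ 2 * θ - 1 := by linarith
          gcongr
    refine le_of_mul_le_mul_right (a := D) ?_ hD
    linarith

section ErrorBound

variable {f : EuclideanSpace ℝ (Fin d) → ℝ} {g : EuclideanSpace ℝ (Fin d) → EReal}
  {L θ ξ c τ : ℝ} {z x p : EuclideanSpace ℝ (Fin d)}

theorem optValue_eq (hp : p ∈ optSet (objective f g)) :
    optValue (objective f g) = objective f g p :=
  le_antisymm (iInf_le _ p) (le_iInf hp)

theorem objective_sub_optValue (hc : IsComposite f g L) (hp : p ∈ optSet (objective f g))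
    (hx : g x ≠ ⊤) (z : EuclideanSpace ℝ (Fin d)) :
    objective f g x - optValue (objective f g)
      = ((regObjective f g 0 z x - regObjective f g 0 z p : ℝ) : EReal) := by
  rw [optValue_eq hp, objective_eq_coe hc.proper hx z,
    objective_eq_coe hc.proper (hc.ne_top_of_mem_optSet hp) z, EReal.coe_sub]

theorem HolderErrorBound.infDist_le (h : HolderErrorBound (objective f g) ξ θ c)
    (hc : IsComposite f g L) (hp : p ∈ optSet (objective f g)) (hx : g x ≠ ⊤)
    (hgap : regObjective f g 0 z x - regObjective f g 0 z p ≤ ξ) :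
    Metric.infDist x (optSet (objective f g))
      ≤ c * (regObjective f g 0 z x - regObjective f g 0 z p) ^ θ := by
  have h1 := h x
  rw [objective_sub_optValue hc hp hx z, EReal.toReal_coe] at h1
  exact h1 (EReal.coe_le_coe_iff.2 hgap)

theorem isClosed_optSet (hc : IsComposite f g L) : IsClosed (optSet (objective f g)) := by
  have h1 : LowerSemicontinuous (objective f g) := by
    refine LowerSemicontinuous.add' (continuous_coe_real_ereal.comp
      hc.smooth.differentiable.continuous).lowerSemicontinuous hc.proper.lsc fun u => ?_
    exact EReal.continuousAt_add (.inl (EReal.coe_ne_top _)) (.inl (EReal.coe_ne_bot _))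
  have h2 : optSet (objective f g) = ⋂ y, objective f g ⁻¹' Set.Iic (objective f g y) := by
    ext x
    simp [optSet]
  rw [h2]
  exact isClosed_iInter fun y => h1.isClosed_preimage _

theorem exists_nearest (hc : IsComposite f g L) (x : EuclideanSpace ℝ (Fin d)) :
    ∃ p ∈ optSet (objective f g), ‖p - x‖ = Metric.infDist x (optSet (objective f g)) := by
  obtain ⟨p, hp, h⟩ := (isClosed_optSet hc).exists_infDist_eq_dist hc.exists_min x
  exact ⟨p, hp, by rw [h, dist_comm, dist_eq_norm]⟩

/-- The error bound for the proximal gradient: a point with `‖G(z)‖ ≤ τ` has distance at most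
`τ / L + D` to the optimal set, where `D`, the distance of the next proximal gradient iterate, is
at most `τ / L` or satisfies the Hölderian bound with a gap `Δ ≤ 2 τ D`. -/
theorem exists_near_of_norm_proxGrad_le (hc : IsComposite f g L)
    (hH : HolderErrorBound (objective f g) ξ θ c) (hz : g z ≠ ⊤)
    (hgap : ∀ p ∈ optSet (objective f g), regObjective f g 0 z z - regObjective f g 0 z p ≤ ξ)
    (hG : ‖proxGrad f g (1 / L) z‖ ≤ τ) :
    ∃ p ∈ optSet (objective f g), ∃ D, 0 ≤ D ∧ ‖p - z‖ ≤ τ / L + D ∧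
      (D ≤ τ / L ∨ τ / L < D ∧ ∃ Δ, 0 ≤ Δ ∧ Δ ≤ ξ ∧ Δ ≤ 2 * τ * D ∧ D ≤ c * Δ ^ θ) := by
  have hL := hc.pos
  obtain ⟨p, hp, hpD⟩ := exists_nearest hc (proxStep f g L z)
  have hs := hc.isSubgradient_proxStep z
  refine ⟨p, hp, _, norm_nonneg (p - proxStep f g L z), ?_, ?_⟩
  · have h1 : ‖z - proxStep f g L z‖ ≤ τ / L := by
      rw [le_div_iff₀ hL, mul_comm, ← hc.norm_proxGrad]
      exact hG
    rw [norm_sub_rev] at h1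
    rw [add_comm]
    refine (norm_sub_le_norm_sub_add_norm_sub p (proxStep f g L z) z).trans ?_
    linarith
  · rw [or_iff_not_imp_left, not_le]
    intro hlt
    refine ⟨hlt, _, sub_nonneg.2 (hc.le_of_mem_optSet hp z hs.1), ?_, ?_, ?_⟩
    · have h1 := hc.norm_proxGrad_sq_le z hz
      have h2 : 0 ≤ regObjective f g 0 z z - regObjective f g 0 z (proxStep f g L z) := by
        by_contra! h3
        nlinarith [sq_nonneg ‖proxGrad f g (1 / L) z‖]
      linarith [hgap p hp]
    · have h1 := hc.regObjective_proxStep_le (x := z) z (hc.ne_top_of_mem_optSet hp)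
      have h2 := (abs_le.1 (abs_real_inner_le_norm (z - proxStep f g L z)
        (p - proxStep f g L z))).1
      rw [hc.norm_proxGrad] at hG
      set e := ‖z - proxStep f g L z‖
      set D := ‖p - proxStep f g L z‖
      have h3 : L * e * D ≤ τ * D := by gcongr
      have h4 : L * e ^ 2 ≤ τ * D := by
        have h5 : e ≤ τ / L := by rwa [le_div_iff₀ hL, mul_comm]
        have h6 : L * e * e ≤ τ * D := by
          have : 0 ≤ τ := le_trans (by positivity) hG
          gcongr
          linarith
        linarith
      nlinarith
    · rw [hpD]
      refine hH.infDist_le hc hp hs.1 ?_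
      have h1 := hc.norm_proxGrad_sq_le z hz
      have h2 : 0 ≤ regObjective f g 0 z z - regObjective f g 0 z (proxStep f g L z) := by
        by_contra! h3
        nlinarith [sq_nonneg ‖proxGrad f g (1 / L) z‖]
      linarith [hgap p hp]

end ErrorBound

/-! ### The inner iterations of one cycle -/

/-- An inner iteration of adaAGC without the two tests, for a fixed regularization parameter. -/
noncomputable def innerStep (f : EuclideanSpace ℝ (Fin d) → ℝ)
    (g : EuclideanSpace ℝ (Fin d) → EReal) (L δ : ℝ) (S : State d) : State d :=
  let gδ := regularized g δ S.center
  let a := adgWeight L δ S.A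
  let A' := S.A + a
  let y := (S.A / A') • S.x + (a / A') • S.v
  let x' := prox (1 / L) gδ (y - (1 / L) • gradient f y)
  let s' := S.s + a • gradient f x'
  let v' := argmin fun u =>
    ((1 / 2 * ‖u - S.center‖ ^ 2 + inner ℝ s' u : ℝ) : EReal) + (A' : EReal) * gδ u
  { S with t := S.t + 1, A := A', x := x', v := v', s := s' }

/-- The `i`-th state of a cycle which is never stopped by a test. -/
noncomputable def innerState (f : EuclideanSpace ℝ (Fin d) → ℝ)
    (g : EuclideanSpace ℝ (Fin d) → EReal) (L δ : ℝ) (k : ℕ) (z : EuclideanSpace ℝ (Fin d))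
    (τ ce : ℝ) (i : ℕ) : State d :=
  (innerStep f g L δ)^[i] (startCycle k z τ ce)

section Inner

variable {f : EuclideanSpace ℝ (Fin d) → ℝ} {g : EuclideanSpace ℝ (Fin d) → EReal}
  {L δ τ ce : ℝ} {k : ℕ} {z : EuclideanSpace ℝ (Fin d)}

theorem step_eq (f : EuclideanSpace ℝ (Fin d) → ℝ) (g : EuclideanSpace ℝ (Fin d) → EReal)
    (L θ γ ξ : ℝ) (S : State d) :
    step f g L θ γ ξ S =
      if ‖proxGrad f g (1 / L) (innerStep f g L (regParam θ L ξ S.tol S.ce) S).x‖ ≤ S.tol / 2 then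
        startCycle (S.stage + 1) (innerStep f g L (regParam θ L ξ S.tol S.ce) S).x (S.tol / 2) S.ce
      else if S.t = cycleLength L (regParam θ L ξ S.tol S.ce) then
        startCycle S.stage S.center S.tol (γ * S.ce)
      else innerStep f g L (regParam θ L ξ S.tol S.ce) S := rfl

theorem innerState_succ (i : ℕ) : innerState f g L δ k z τ ce (i + 1)
    = innerStep f g L δ (innerState f g L δ k z τ ce i) :=
  Function.iterate_succ_apply' _ _ _

theorem innerState_const (i : ℕ) :
    (innerState f g L δ k z τ ce i).t = i ∧ (innerState f g L δ k z τ ce i).stage = k ∧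
      (innerState f g L δ k z τ ce i).center = z ∧ (innerState f g L δ k z τ ce i).tol = τ ∧
      (innerState f g L δ k z τ ce i).ce = ce := by
  induction i with
  | zero => exact ⟨rfl, rfl, rfl, rfl, rfl⟩
  | succ i ih =>
    rw [innerState_succ]
    obtain ⟨h1, h2, h3, h4, h5⟩ := ih
    exact ⟨congrArg (· + 1) h1, h2, h3, h4, h5⟩

theorem innerState_A_succ (i : ℕ) : (innerState f g L δ k z τ ce (i + 1)).A
    = (innerState f g L δ k z τ ce i).A + adgWeight L δ (innerState f g L δ k z τ ce i).A := by
  rw [innerState_succ]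
  rfl

theorem estimateInvariant_innerState (hc : IsComposite f g L) (hδ : 0 ≤ δ) (hz : g z ≠ ⊤) (i : ℕ) :
    EstimateInvariant f g δ z (innerState f g L δ k z τ ce i).A (innerState f g L δ k z τ ce i).x
      (innerState f g L δ k z τ ce i).v (innerState f g L δ k z τ ce i).s := by
  induction i with
  | zero => exact EstimateInvariant.start hz
  | succ i ih =>
    have hcen := (innerState_const (f := f) (g := g) (L := L) (δ := δ) (k := k) (z := z) (τ := τ)
      (ce := ce) i).2.2.1
    rw [innerState_succ]
    refine ih.step hc hδ rfl rfl rfl ?_ rfl ?_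
    · simp only [innerStep, hcen]
    · simp only [innerStep, hcen]

theorem innerState_A_nonneg (hL : 0 < L) (hδ : 0 ≤ δ) (i : ℕ) :
    0 ≤ (innerState f g L δ k z τ ce i).A := by
  induction i with
  | zero => exact le_rfl
  | succ i ih =>
    rw [innerState_A_succ]
    exact add_nonneg ih (adgWeight_pos hL hδ ih).le

theorem le_innerState_A (hL : 0 < L) (hδ : 0 ≤ δ) (i : ℕ) :
    (i : ℝ) ^ 2 / (2 * L) ≤ (innerState f g L δ k z τ ce i).A := by
  have h : i * √(1 / (2 * L)) ≤ √(innerState f g L δ k z τ ce i).A := by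
    induction i with
    | zero => simp
    | succ i ih =>
      have hA := innerState_A_nonneg (f := f) (g := g) (k := k) (z := z) (τ := τ) (ce := ce) hL hδ i
      rw [innerState_A_succ]
      refine le_trans ?_ (sqrt_add_adgWeight_ge hL hδ hA)
      have h1 : √(1 / (2 * L)) ≤ √((1 + δ * (innerState f g L δ k z τ ce i).A) / (2 * L)) := by
        gcongr
        nlinarith [mul_nonneg hδ hA]
      push_cast
      linarith
  have h3 := Real.sq_sqrt (innerState_A_nonneg (f := f) (g := g) (k := k) (z := z) (τ := τ)
    (ce := ce) hL hδ i)
  rw [← h3]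
  refine le_trans (le_of_eq ?_) (pow_le_pow_left₀ (by positivity) h 2)
  rw [mul_pow, Real.sq_sqrt (by positivity)]
  ring

/-- The weight `A_{i+1}` starts from `A_1 = 2 / L`; the constant matters for the exact length of a
cycle. -/
theorem geometric_le_innerState_A (hL : 0 < L) (hδ : 0 ≤ δ) (i : ℕ) :
    2 / L * ((1 + √(δ / (2 * L))) ^ i) ^ 2 ≤ (innerState f g L δ k z τ ce (i + 1)).A := by
  have h : √(2 / L) * (1 + √(δ / (2 * L))) ^ i
      ≤ √(innerState f g L δ k z τ ce (i + 1)).A := by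
    induction i with
    | zero =>
      rw [innerState_A_succ]
      change _ ≤ √(0 + adgWeight L δ 0)
      rw [adgWeight_zero hL]
      simp
    | succ i ih =>
      have hA := innerState_A_nonneg (f := f) (g := g) (k := k) (z := z) (τ := τ) (ce := ce)
        hL hδ (i + 1)
      rw [innerState_A_succ]
      refine le_trans ?_ (sqrt_add_adgWeight_ge hL hδ hA)
      set A := (innerState f g L δ k z τ ce (i + 1)).A
      have h1 : √A * √(δ / (2 * L)) ≤ √((1 + δ * A) / (2 * L)) := by
        rw [← Real.sqrt_mul hA]
        gcongr
        rw [mul_div_assoc']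
        gcongr
        linarith
      rw [pow_succ, ← mul_assoc]
      have h2 := mul_le_mul_of_nonneg_right ih (show 0 ≤ 1 + √(δ / (2 * L)) by positivity)
      linarith
  have h3 := Real.sq_sqrt (innerState_A_nonneg (f := f) (g := g) (k := k) (z := z) (τ := τ)
    (ce := ce) hL hδ (i + 1))
  rw [← h3]
  refine le_trans (le_of_eq ?_) (pow_le_pow_left₀ (by positivity) h 2)
  rw [mul_pow, Real.sq_sqrt (by positivity)]

end Inner

/-! ### The length of a cycle -/

section CycleLength

variable {L δ : ℝ}

theorem le_cycleLength (hδ : 0 < δ) (hδL : δ ≤ L / 32) :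
    √(2 * (L / δ)) * Real.log (L / δ) ≤ cycleLength L δ := by
  have hL : 0 < L := by linarith
  refine le_trans ?_ (Nat.le_ceil _)
  rw [mul_div_assoc]
  gcongr
  exact Real.le_sqrt_of_sq_le (by nlinarith)

theorem seven_le_cycleLength (hδ : 0 < δ) (hδL : δ ≤ L / 32) : 7 ≤ cycleLength L δ := by
  have h := le_cycleLength hδ hδL
  have hq : 32 ≤ L / δ := by rw [le_div_iff₀ hδ]; linarith
  have h1 : (7 : ℝ) ≤ √(2 * (L / δ)) := Real.le_sqrt_of_sq_le (by linarith)
  have h2 : 1 ≤ Real.log (L / δ) := by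
    rw [Real.le_log_iff_exp_le (by linarith)]
    linarith [Real.exp_one_lt_d9]
  have h3 : (7 : ℝ) ≤ cycleLength L δ := by nlinarith
  exact_mod_cast h3

/-- At the end of a full cycle the weight has reached `L / (4 δ²)`. With `q = L / δ`, the growth
factor per iteration is `1 + 1/√(2q)`, whose logarithm is smaller than `1/√(2q)` only by a factor
which costs at most `e` in the power. -/
theorem div_le_geometric_cycleLength (hδ : 0 < δ) (hδL : δ ≤ L / 32) :
    L / (4 * δ ^ 2) ≤ 2 / L * ((1 + √(δ / (2 * L))) ^ cycleLength L δ) ^ 2 := by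
  have hL : 0 < L := by linarith
  have h := le_cycleLength hδ hδL
  have hq : 32 ≤ L / δ := by rw [le_div_iff₀ hδ]; linarith
  set T := cycleLength L δ
  have hr : √(δ / (2 * L)) = 1 / √(2 * (L / δ)) := by
    rw [← Real.sqrt_one, ← Real.sqrt_div zero_le_one]
    congr 1
    field_simp
  rw [hr]
  set q := L / δ with hqdef
  set R := √(2 * q) with hR
  have hRpos : 0 < R := Real.sqrt_pos.2 (by linarith)
  have hlogq : 0 ≤ Real.log q := Real.log_nonneg (by linarith)
  have h1 : Real.log q - 1 ≤ T * Real.log (1 + 1 / R) := by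
    have h2 := Real.le_log_one_add_of_nonneg (show 0 ≤ 1 / R by positivity)
    have h3 : 2 * (1 / R) / (1 / R + 2) = 1 / (R + 1 / 2) := by field_simp; ring
    rw [h3] at h2
    have h4 : Real.log q - 1 ≤ R * Real.log q * (1 / (R + 1 / 2)) := by
      rw [mul_one_div, le_div_iff₀ (by positivity)]
      have h5 : Real.log q ≤ 2 * R := by
        have h6 : Real.log q = 2 * Real.log √q := by
          rw [Real.log_sqrt (by linarith)]; ring
        have h7 : Real.log √q ≤ √q :=
          (Real.log_le_sub_one_of_pos (Real.sqrt_pos.2 (by linarith))).trans (by linarith)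
        have h8 : √q ≤ R := Real.sqrt_le_sqrt (by linarith)
        linarith
      nlinarith
    refine h4.trans ?_
    gcongr
  have h2 : q / Real.exp 1 ≤ (1 + 1 / R) ^ T := by
    rw [← Real.log_le_log_iff (by positivity) (by positivity), Real.log_pow,
      Real.log_div (by positivity) (by positivity), Real.log_exp]
    exact h1
  have h3 : Real.exp 1 ^ 2 ≤ 8 := by
    have := Real.exp_one_lt_d9
    have := Real.exp_pos 1
    nlinarith
  calc L / (4 * δ ^ 2) = 2 / L * (q ^ 2 / 8) := by rw [hqdef]; field_simp; norm_num
    _ ≤ 2 / L * (q ^ 2 / Real.exp 1 ^ 2) := by gcongr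
    _ = 2 / L * (q / Real.exp 1) ^ 2 := by rw [div_pow q]
    _ ≤ _ := by gcongr

theorem cycleLength_add_one_le {Q : ℝ} (hL : 0 < L) (hQ : 0 < Q)
    (hδ : δ = min (L / 32) (1 / (16 * Q))) :
    (cycleLength L δ : ℝ) + 1 ≤ 120 * (1 + √(L * Q) * Real.log (2 + L * Q)) := by
  have hδpos : 0 < δ := by rw [hδ]; positivity
  have hδL : δ ≤ L / 32 := by rw [hδ]; exact min_le_left _ _
  set X := L * Q with hX
  have hXpos : 0 < X := by positivity
  have hq : L / δ ≤ 32 * (1 + X) := by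
    rw [div_le_iff₀ hδpos, hδ]
    rcases le_total (L / 32) (1 / (16 * Q)) with h | h
    · rw [min_eq_left h]
      nlinarith
    · rw [min_eq_right h]
      have : 32 * (1 + X) * (1 / (16 * Q)) = 2 / Q + 2 * L := by rw [hX]; field_simp; ring
      rw [this]
      have : 0 < 2 / Q := by positivity
      linarith
  have hq32 : 32 ≤ L / δ := by rw [le_div_iff₀ hδpos]; linarith
  have hl1 : 0 < Real.log (2 + X) := Real.log_pos (by linarith)
  have h0 : 0 ≤ Real.log (√(L * (L + δ)) / δ) := by
    refine Real.log_nonneg ?_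
    rw [le_div_iff₀ hδpos, one_mul]
    exact Real.le_sqrt_of_sq_le (by nlinarith)
  have h1 : Real.log (√(L * (L + δ)) / δ) ≤ 7 * Real.log (2 + X) := by
    have h2 : √(L * (L + δ)) / δ ≤ (2 + X) ^ 7 := by
      have h3 : √(L * (L + δ)) ≤ 2 * L := Real.sqrt_le_iff.2 ⟨by linarith, by nlinarith⟩
      calc √(L * (L + δ)) / δ ≤ 2 * L / δ := by gcongr
        _ = 2 * (L / δ) := by ring
        _ ≤ 2 ^ 6 * (2 + X) := by linarith
        _ ≤ (2 + X) ^ 6 * (2 + X) := by gcongr; linarith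
        _ = (2 + X) ^ 7 := by ring
    calc _ ≤ Real.log ((2 + X) ^ 7) := Real.log_le_log (by positivity) h2
      _ = _ := by rw [Real.log_pow]; norm_num
  have h2 : √(2 * L / δ) ≤ 8 * (1 + √X) := by
    refine Real.sqrt_le_iff.2 ⟨by positivity, ?_⟩
    have h3 := Real.sq_sqrt hXpos.le
    have h4 := Real.sqrt_nonneg X
    rw [mul_div_assoc]
    nlinarith
  have h3 : (cycleLength L δ : ℝ) ≤ √(2 * L / δ) * Real.log (√(L * (L + δ)) / δ) + 1 := by
    exact (Nat.ceil_lt_add_one (mul_nonneg (Real.sqrt_nonneg _) h0)).le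
  have h4 : √(2 * L / δ) * Real.log (√(L * (L + δ)) / δ)
      ≤ 8 * (1 + √X) * (7 * Real.log (2 + X)) := by gcongr
  have h5 : Real.log (2 + X) ≤ 2 + √X * Real.log (2 + X) := by
    rcases le_total X 1 with h | h
    · have h6 : Real.log (2 + X) ≤ (2 + X) - 1 := Real.log_le_sub_one_of_pos (by linarith)
      have : 0 ≤ √X * Real.log (2 + X) := by positivity
      linarith
    · have h6 : 1 ≤ √X := Real.one_le_sqrt.2 h
      nlinarith
  have h6 : 0 ≤ √X * Real.log (2 + X) := by positivity
  linarith

end CycleLength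

/-! ### The outcome of one cycle -/

section Cycle

/-- Started in stage `k` at `z`, the algorithm completes the stage after `n` iterations, at a point
that halves the tolerance and does not increase the objective, without changing the guess `ce`. -/
def Completes (f : EuclideanSpace ℝ (Fin d) → ℝ) (g : EuclideanSpace ℝ (Fin d) → EReal)
    (L θ γ ξ : ℝ) (k : ℕ) (z : EuclideanSpace ℝ (Fin d)) (τ ce : ℝ) (n : ℕ) : Prop :=
  ∃ z', g z' ≠ ⊤ ∧ regObjective f g 0 z z' ≤ regObjective f g 0 z z ∧
    ‖proxGrad f g (1 / L) z'‖ ≤ τ / 2 ∧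
    (step f g L θ γ ξ)^[n] (startCycle k z τ ce) = startCycle (k + 1) z' (τ / 2) ce

/-- The algorithm gives up a cycle after `n` iterations and restarts with the guess `γ ce`. -/
def GivesUp (f : EuclideanSpace ℝ (Fin d) → ℝ) (g : EuclideanSpace ℝ (Fin d) → EReal)
    (L θ γ ξ : ℝ) (k : ℕ) (z : EuclideanSpace ℝ (Fin d)) (τ ce : ℝ) (n : ℕ) : Prop :=
  (step f g L θ γ ξ)^[n] (startCycle k z τ ce) = startCycle k z τ (γ * ce)

variable {f : EuclideanSpace ℝ (Fin d) → ℝ} {g : EuclideanSpace ℝ (Fin d) → EReal}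
  {L δ θ γ ξ τ ce : ℝ} {k : ℕ} {z : EuclideanSpace ℝ (Fin d)}

theorem step_innerState (hδ : δ = regParam θ L ξ τ ce) (i : ℕ) :
    step f g L θ γ ξ (innerState f g L δ k z τ ce i) =
      if ‖proxGrad f g (1 / L) (innerState f g L δ k z τ ce (i + 1)).x‖ ≤ τ / 2 then
        startCycle (k + 1) (innerState f g L δ k z τ ce (i + 1)).x (τ / 2) ce
      else if i = cycleLength L δ then startCycle k z τ (γ * ce)
      else innerState f g L δ k z τ ce (i + 1) := by
  obtain ⟨h1, h2, h3, h4, h5⟩ := innerState_const (f := f) (g := g) (L := L) (δ := δ) (k := k)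
    (z := z) (τ := τ) (ce := ce) i
  rw [step_eq, h1, h2, h3, h4, h5, ← hδ, ← innerState_succ]

theorem iterate_step_startCycle (hδ : δ = regParam θ L ξ τ ce) {n : ℕ} (hn : n ≤ cycleLength L δ)
    (htest : ∀ i < n, ¬ ‖proxGrad f g (1 / L) (innerState f g L δ k z τ ce (i + 1)).x‖ ≤ τ / 2) :
    (step f g L θ γ ξ)^[n] (startCycle k z τ ce) = innerState f g L δ k z τ ce n := by
  induction n with
  | zero => rfl
  | succ n ih =>
    rw [Function.iterate_succ_apply', ih (by omega) fun i hi => htest i (by omega),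
      step_innerState hδ, if_neg (htest n (by omega)), if_neg (by omega)]

theorem exists_completes (hc : IsComposite f g L) (hδ : δ = regParam θ L ξ τ ce) (hδ0 : 0 ≤ δ)
    (hz : g z ≠ ⊤) {m : ℕ} (hm : m ≤ cycleLength L δ)
    (htest : ‖proxGrad f g (1 / L) (innerState f g L δ k z τ ce (m + 1)).x‖ ≤ τ / 2) :
    ∃ n ≤ m + 1, Completes f g L θ γ ξ k z τ ce n := by
  classical
  have hex : ∃ i, ‖proxGrad f g (1 / L) (innerState f g L δ k z τ ce (i + 1)).x‖ ≤ τ / 2 :=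
    ⟨m, htest⟩
  have hle : Nat.find hex ≤ m := Nat.find_min' hex htest
  have hinv := estimateInvariant_innerState (k := k) (τ := τ) (ce := ce) hc hδ0 hz
    (Nat.find hex + 1)
  refine ⟨Nat.find hex + 1, by omega, _, hinv.ne_top, hinv.le_center hδ0 ?_ hz,
    Nat.find_spec hex, ?_⟩
  · rw [innerState_A_succ]
    have h1 := innerState_A_nonneg (f := f) (g := g) (k := k) (z := z) (τ := τ) (ce := ce)
      hc.pos hδ0 (Nat.find hex)
    linarith [adgWeight_pos hc.pos hδ0 h1]
  · rw [Function.iterate_succ_apply', iterate_step_startCycle hδ (by omega)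
      fun i hi => Nat.find_min hex hi, step_innerState hδ, if_pos (Nat.find_spec hex)]

theorem exists_completes_or_givesUp (hc : IsComposite f g L) (hδ : δ = regParam θ L ξ τ ce)
    (hδ0 : 0 ≤ δ) (hz : g z ≠ ⊤) :
    ∃ n ≤ cycleLength L δ + 1,
      Completes f g L θ γ ξ k z τ ce n ∨ GivesUp f g L θ γ ξ k z τ ce n := by
  by_cases h : ∃ i ≤ cycleLength L δ,
      ‖proxGrad f g (1 / L) (innerState f g L δ k z τ ce (i + 1)).x‖ ≤ τ / 2
  · obtain ⟨i, hi, htest⟩ := h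
    obtain ⟨n, hn, h⟩ := exists_completes (γ := γ) hc hδ hδ0 hz hi htest
    exact ⟨n, by omega, .inl h⟩
  · push Not at h
    refine ⟨cycleLength L δ + 1, le_rfl, .inr ?_⟩
    rw [GivesUp, Function.iterate_succ_apply', iterate_step_startCycle hδ le_rfl
      fun i hi => (h i hi.le).not_ge, step_innerState hδ, if_neg (h _ le_rfl).not_ge, if_pos rfl]

variable {c : ℝ}

theorem regParam_pos (hL : 0 < L) (hξ : 0 < ξ) (hτ : 0 < τ) (hce : 0 < ce) :
    0 < regParam θ L ξ τ ce := by
  have := errorFactor_pos (θ := θ) hξ hτ hce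
  rw [regParam_eq]
  positivity

theorem regParam_le : regParam θ L ξ τ ce ≤ L / 32 := by
  rw [regParam_eq]
  exact min_le_left _ _

/-- A cycle whose guess `ce` is at least the constant `c` of the error bound completes its stage. -/
theorem exists_completes_of_le (hc : IsComposite f g L)
    (hH : HolderErrorBound (objective f g) ξ θ c) (hθ0 : 0 < θ) (hξ : 0 < ξ) (hτ : 0 < τ)
    (hc0 : 0 < c) (hce : c ≤ ce) (hz : g z ≠ ⊤)
    (hgap : ∀ p ∈ optSet (objective f g), regObjective f g 0 z z - regObjective f g 0 z p ≤ ξ)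
    (hG : ‖proxGrad f g (1 / L) z‖ ≤ τ) :
    ∃ n ≤ cycleLength L (regParam θ L ξ τ ce) + 1, Completes f g L θ γ ξ k z τ ce n := by
  have hL := hc.pos
  have hδ := regParam_pos (θ := θ) hL hξ hτ (hc0.trans_le hce)
  have hδL := regParam_le (θ := θ) (L := L) (ξ := ξ) (τ := τ) (ce := ce)
  obtain ⟨p, hp, D, hD0, hpz, hD⟩ := exists_near_of_norm_proxGrad_le hc hH hz hgap hG
  have hQ := errorFactor_pos (θ := θ) hξ hτ hc0
  have hDle : D ≤ τ / L + errorFactor θ ξ τ c * τ := by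
    rcases hD with hD | ⟨-, Δ, hΔ, hΔξ, hΔD, hD⟩
    · have : 0 ≤ errorFactor θ ξ τ c * τ := by positivity
      linarith
    · have := le_errorFactor_mul hθ0 hξ hτ hc0 hD0 hΔ hΔξ hΔD hD
      have : 0 ≤ τ / L := by positivity
      linarith
  have hδQ : regParam θ L ξ τ ce * errorFactor θ ξ τ c ≤ 1 / 16 := by
    have h1 := errorFactor_mono (θ := θ) hξ hτ hc0 hce
    have h2 := errorFactor_pos (θ := θ) hξ hτ (hc0.trans_le hce)
    have h3 : regParam θ L ξ τ ce ≤ 1 / (16 * errorFactor θ ξ τ ce) := by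
      rw [regParam_eq]
      exact min_le_right _ _
    rw [le_div_iff₀ (by positivity)] at h3
    nlinarith
  set δ := regParam θ L ξ τ ce with hδdef
  refine exists_completes hc hδdef hδ.le hz le_rfl
    ((estimateInvariant_innerState hc hδ.le hz _).norm_proxGrad_le_of_large hc hδ hδL
      ((div_le_geometric_cycleLength hδ hδL).trans (geometric_le_innerState_A hL hδ.le _)) hp ?_)
  have h1 : δ * ‖p - z‖ ≤ δ * (2 * (τ / L) + errorFactor θ ξ τ c * τ) := by
    gcongr
    linarith
  have h2 : δ * (τ / L) ≤ τ / 32 := by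
    calc δ * (τ / L) ≤ L / 32 * (τ / L) := by gcongr
      _ = τ / 32 := by field_simp
  nlinarith

/-- When the error bound term is dominated by `τ / L`, eight iterations complete the stage. -/
theorem exists_completes_of_fast (hc : IsComposite f g L)
    (hH : HolderErrorBound (objective f g) ξ θ c) (hξ : 0 < ξ) (hτ : 0 < τ)
    (hce : 0 < ce) (hz : g z ≠ ⊤)
    (hgap : ∀ p ∈ optSet (objective f g), regObjective f g 0 z z - regObjective f g 0 z p ≤ ξ)
    (hG : ‖proxGrad f g (1 / L) z‖ ≤ τ)
    (hfast : ∀ D Δ, 0 ≤ Δ → Δ ≤ ξ → Δ ≤ 2 * τ * D → D ≤ c * Δ ^ θ → D ≤ τ / L) :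
    ∃ n ≤ 8, Completes f g L θ γ ξ k z τ ce n := by
  have hL := hc.pos
  have hδ := regParam_pos (θ := θ) hL hξ hτ hce
  have hδL := regParam_le (θ := θ) (L := L) (ξ := ξ) (τ := τ) (ce := ce)
  obtain ⟨p, hp, D, hD0, hpz, hD⟩ := exists_near_of_norm_proxGrad_le hc hH hz hgap hG
  have hDle : D ≤ τ / L := by
    rcases hD with hD | ⟨-, Δ, hΔ, hΔξ, hΔD, hD⟩
    · exact hD
    · exact hfast D Δ hΔ hΔξ hΔD hD
  refine exists_completes hc rfl hδ.le hz (seven_le_cycleLength hδ hδL)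
    ((estimateInvariant_innerState hc hδ.le hz _).norm_proxGrad_le_of_near hc hδ.le hδL
      (le_trans (le_of_eq ?_) (le_innerState_A hL hδ.le 8)) hτ.le hp (hpz.trans ?_))
  · push_cast
    field_simp
    norm_num
  · rw [mul_div_assoc]
    linarith

end Cycle

/-! ### Accounting of stages and cycles -/

/-- An upper bound for the number of iterations of a cycle with `L Q = X`. -/
noncomputable def cycleCost (X : ℝ) : ℝ := 120 * (1 + √X * Real.log (2 + X))

theorem cycleCost_mono {X Y : ℝ} (hX : 0 ≤ X) (h : X ≤ Y) : cycleCost X ≤ cycleCost Y := by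
  unfold cycleCost
  have : 0 ≤ Real.log (2 + X) := Real.log_nonneg (by linarith)
  gcongr

section Accounting

variable {f : EuclideanSpace ℝ (Fin d) → ℝ} {g : EuclideanSpace ℝ (Fin d) → EReal}
  {L θ γ ξ c c₀ ε τ ce : ℝ} {k K : ℕ} {z x₀ : EuclideanSpace ℝ (Fin d)}

theorem cycle_outcome (hc : IsComposite f g L) (hH : HolderErrorBound (objective f g) ξ θ c)
    (hθ0 : 0 < θ) (hξ : 0 < ξ) (hτ : 0 < τ) (hc0 : 0 < c) (hce : 0 < ce) (hceγ : ce ≤ γ * c)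
    (hz : g z ≠ ⊤)
    (hgap : ∀ p ∈ optSet (objective f g), regObjective f g 0 z z - regObjective f g 0 z p ≤ ξ)
    (hG : ‖proxGrad f g (1 / L) z‖ ≤ τ) :
    (∃ n : ℕ, (n : ℝ) ≤ cycleCost (L * errorFactor θ ξ τ (γ * c)) ∧
        Completes f g L θ γ ξ k z τ ce n) ∨
      (ce < c ∧ ∃ n : ℕ, (n : ℝ) ≤ cycleCost (L * errorFactor θ ξ τ (γ * c)) ∧
        GivesUp f g L θ γ ξ k z τ ce n) := by
  have hL := hc.pos
  have hQ := errorFactor_pos (θ := θ) hξ hτ hce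
  have hcost : (cycleLength L (regParam θ L ξ τ ce) : ℝ) + 1
      ≤ cycleCost (L * errorFactor θ ξ τ (γ * c)) := by
    refine (cycleLength_add_one_le hL hQ (regParam_eq θ L ξ τ ce)).trans
      (cycleCost_mono (by positivity) ?_)
    have := errorFactor_mono (θ := θ) hξ hτ hce hceγ
    gcongr
  have hcast : ∀ n : ℕ, n ≤ cycleLength L (regParam θ L ξ τ ce) + 1 →
      (n : ℝ) ≤ cycleCost (L * errorFactor θ ξ τ (γ * c)) := fun n hn =>
    le_trans (by exact_mod_cast hn) hcost
  rcases le_or_gt c ce with h | h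
  · obtain ⟨n, hn, hcomp⟩ :=
      exists_completes_of_le (γ := γ) (k := k) hc hH hθ0 hξ hτ hc0 h hz hgap hG
    exact .inl ⟨n, hcast n hn, hcomp⟩
  · obtain ⟨n, hn, hcomp | hgive⟩ := exists_completes_or_givesUp (γ := γ) (k := k) hc rfl
      (regParam_pos hL hξ hτ hce).le hz
    · exact .inl ⟨n, hcast n hn, hcomp⟩
    · exact .inr ⟨h, n, hcast n hn, hgive⟩

/-- If every cycle of stage `k` either completes the stage within `W k` iterations or gives up
within `B` iterations, the latter only while `ce < c`, then the total cost is at most the sum of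
the `W k` plus `B` for each of the at most `1 + log_γ (c / c₀)` increases of `ce`. -/
theorem exists_run_stage (hγ : 1 < γ) (hc₀ : 0 < c₀) (hcc : c₀ ≤ c) {W : ℕ → ℝ} {B : ℝ}
    (hB : 0 ≤ B) (hx₀ : g x₀ ≠ ⊤)
    (hstage : ∀ k < K, ∀ z ce, g z ≠ ⊤ → regObjective f g 0 x₀ z ≤ regObjective f g 0 x₀ x₀ →
      ‖proxGrad f g (1 / L) z‖ ≤ ‖proxGrad f g (1 / L) x₀‖ / 2 ^ k → 0 < ce → ce ≤ γ * c →
      (∃ n : ℕ, (n : ℝ) ≤ W k ∧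
        Completes f g L θ γ ξ k z (‖proxGrad f g (1 / L) x₀‖ / 2 ^ k) ce n) ∨
      (ce < c ∧ ∃ n : ℕ, (n : ℝ) ≤ B ∧
        GivesUp f g L θ γ ξ k z (‖proxGrad f g (1 / L) x₀‖ / 2 ^ k) ce n)) :
    ∃ N : ℕ, (run f g L θ γ ξ c₀ x₀ N).stage = K ∧
      ‖proxGrad f g (1 / L) (run f g L θ γ ξ c₀ x₀ N).center‖
        ≤ ‖proxGrad f g (1 / L) x₀‖ / 2 ^ K ∧
      (N : ℝ) ≤ ∑ k ∈ Finset.range K, W k + B * (1 + Real.logb γ (c / c₀)) := by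
  have hc : 0 < c := hc₀.trans_le hcc
  set τ₀ := ‖proxGrad f g (1 / L) x₀‖ with hτ₀
  have hm : ∀ m : ℕ, c₀ * γ ^ m ≤ γ * c → (m : ℝ) ≤ 1 + Real.logb γ (c / c₀) := by
    intro m hm
    have h1 : γ ^ m ≤ γ * (c / c₀) := by
      rw [mul_div_assoc', le_div_iff₀ hc₀]
      linarith
    have h2 : Real.logb γ (γ ^ m) ≤ Real.logb γ (γ * (c / c₀)) :=
      Real.logb_le_logb_of_le hγ (by positivity) h1
    rwa [Real.logb_mul (by positivity) (by positivity), Real.logb_self_eq_one hγ,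
      Real.logb_pow, Real.logb_self_eq_one hγ, mul_one] at h2
  -- `m` counts the increases of the guess of the constant
  have key : ∀ k ≤ K, ∃ N z, ∃ m : ℕ,
      run f g L θ γ ξ c₀ x₀ N = startCycle k z (τ₀ / 2 ^ k) (c₀ * γ ^ m) ∧ g z ≠ ⊤ ∧
      regObjective f g 0 x₀ z ≤ regObjective f g 0 x₀ x₀ ∧
      ‖proxGrad f g (1 / L) z‖ ≤ τ₀ / 2 ^ k ∧ c₀ * γ ^ m ≤ γ * c ∧
      (N : ℝ) ≤ ∑ j ∈ Finset.range k, W j + B * m := by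
    intro k hk
    induction k with
    | zero =>
      refine ⟨0, x₀, 0, ?_, hx₀, le_rfl, ?_, ?_, by simp⟩
      · simp [run, hτ₀]
      · simp [hτ₀]
      · rw [pow_zero, mul_one]
        nlinarith
    | succ k ih =>
      obtain ⟨N, z, m, hrun, hz, hF, hG, hmc, hN⟩ := ih (by omega)
      -- the number of increases still possible bounds the number of cycles of the stage
      have aux : ∀ j : ℕ, ∀ (N m : ℕ), (⌊1 + Real.logb γ (c / c₀)⌋₊ - m = j) →
          run f g L θ γ ξ c₀ x₀ N = startCycle k z (τ₀ / 2 ^ k) (c₀ * γ ^ m) →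
          c₀ * γ ^ m ≤ γ * c → (N : ℝ) ≤ ∑ j ∈ Finset.range k, W j + B * m →
          ∃ N z', ∃ m : ℕ,
            run f g L θ γ ξ c₀ x₀ N = startCycle (k + 1) z' (τ₀ / 2 ^ (k + 1)) (c₀ * γ ^ m) ∧
            g z' ≠ ⊤ ∧ regObjective f g 0 x₀ z' ≤ regObjective f g 0 x₀ x₀ ∧
            ‖proxGrad f g (1 / L) z'‖ ≤ τ₀ / 2 ^ (k + 1) ∧ c₀ * γ ^ m ≤ γ * c ∧
            (N : ℝ) ≤ ∑ j ∈ Finset.range (k + 1), W j + B * m := by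
        intro j
        induction j using Nat.strong_induction_on with
        | _ j ihj =>
          intro N m hj hrun hmc hN
          have hcomp : ∀ n, run f g L θ γ ξ c₀ x₀ (n + N)
              = (step f g L θ γ ξ)^[n] (run f g L θ γ ξ c₀ x₀ N) := fun n =>
            Function.iterate_add_apply _ n N _
          rcases hstage k (by omega) z (c₀ * γ ^ m) hz hF hG (by positivity) hmc with
            ⟨n, hn, z', hz', hF', hG', hst⟩ | ⟨hlt, n, hn, hst⟩
          · refine ⟨n + N, z', m, ?_, hz', ?_, ?_, hmc, ?_⟩
            · rw [hcomp, hrun, hst, pow_succ, div_div]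
            · rw [regObjective_zero_center z x₀, regObjective_zero_center z x₀] at hF'
              exact hF'.trans hF
            · rwa [pow_succ, ← div_div]
            · rw [Finset.sum_range_succ]
              push_cast
              linarith
          · have hmc' : c₀ * γ ^ (m + 1) ≤ γ * c := by
              rw [pow_succ]
              nlinarith
            have h1 : m + 1 ≤ ⌊1 + Real.logb γ (c / c₀)⌋₊ := Nat.le_floor (hm _ hmc')
            refine ihj _ ?_ (n + N) (m + 1) rfl ?_ hmc' ?_
            · omega
            · rw [hcomp, hrun, hst]
              congr 1
              ring
            · push_cast
              linarith
      exact aux _ N m rfl hrun hmc hN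
  obtain ⟨N, z, m, hrun, -, -, hG, hmc, hN⟩ := key K le_rfl
  refine ⟨N, ?_, ?_, hN.trans ?_⟩
  · rw [hrun]
    rfl
  · rw [hrun]
    exact hG
  · have := hm m hmc
    gcongr

end Accounting

/-! ### Stages which take a bounded number of iterations -/

theorem le_div_of_errorFactor_le {θ ξ τ c L D Δ : ℝ} (hL : 0 < L) (hθ0 : 0 < θ) (hξ : 0 < ξ)
    (hτ : 0 < τ) (hc : 0 < c) (hQ : L * errorFactor θ ξ τ c ≤ 1) (hΔ : 0 ≤ Δ) (hΔξ : Δ ≤ ξ)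
    (hΔD : Δ ≤ 2 * τ * D) (h : D ≤ c * Δ ^ θ) : D ≤ τ / L := by
  have hD : 0 ≤ D := by
    by_contra! hneg
    nlinarith
  have h1 := le_errorFactor_mul hθ0 hξ hτ hc hD hΔ hΔξ hΔD h
  rw [le_div_iff₀ hL]
  nlinarith

/-- For exponents above `1/2` the error bound term becomes negligible for small tolerances,
whatever the constants are. -/
theorem le_div_of_rpow_lt {θ τ c L D Δ : ℝ} (hL : 0 < L) (hθ0 : 0 < θ) (hθ1 : θ ≤ 1)
    (hτ : 0 < τ) (hc : 0 < c) (hsmall : 2 * c * L ^ (1 - θ) * τ ^ (2 * θ - 1) < 1) (hΔ : 0 ≤ Δ)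
    (hΔD : Δ ≤ 2 * τ * D) (h : D ≤ c * Δ ^ θ) : D ≤ τ / L := by
  by_contra! hlt
  have hD : 0 < D := lt_trans (by positivity) hlt
  have h1 : D ≤ c * (2 * τ ^ θ * D ^ θ) := by
    have h2 : (2 : ℝ) ^ θ ≤ 2 := by
      calc (2 : ℝ) ^ θ ≤ 2 ^ (1 : ℝ) := Real.rpow_le_rpow_of_exponent_le one_le_two hθ1
        _ = 2 := Real.rpow_one 2
    calc D ≤ c * (2 * τ * D) ^ θ := h.trans (by gcongr)
      _ = c * (2 ^ θ * τ ^ θ * D ^ θ) := by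
        rw [Real.mul_rpow (by positivity) hD.le, Real.mul_rpow two_pos.le hτ.le]
      _ ≤ _ := by gcongr
  have h2 : D ^ (1 - θ) ≤ 2 * c * τ ^ θ := by
    rw [Real.rpow_sub hD, Real.rpow_one, div_le_iff₀ (by positivity)]
    linarith
  have h3 : (τ / L) ^ (1 - θ) ≤ D ^ (1 - θ) :=
    Real.rpow_le_rpow (by positivity) hlt.le (by linarith)
  rw [Real.div_rpow hτ.le hL.le] at h3
  have h4 := h3.trans h2
  rw [div_le_iff₀ (by positivity)] at h4
  have h5 : τ ^ θ = τ ^ (2 * θ - 1) * τ ^ (1 - θ) := by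
    rw [← Real.rpow_add hτ]
    congr 1
    ring
  rw [h5] at h4
  have h6 : 0 < τ ^ (1 - θ) := by positivity
  nlinarith

/-! ### The number of stages -/

section NumStages

variable {f : EuclideanSpace ℝ (Fin d) → ℝ} {g : EuclideanSpace ℝ (Fin d) → EReal}
  {L ε : ℝ} {k : ℕ} {x₀ : EuclideanSpace ℝ (Fin d)}

theorem norm_proxGrad_pos_of_numStages (hk : k < numStages f g L x₀ ε) :
    0 < ‖proxGrad f g (1 / L) x₀‖ := by
  refine (norm_nonneg _).lt_of_ne' fun h => ?_
  rw [numStages, h, zero_div, Real.logb_zero, Nat.ceil_zero] at hk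
  omega

theorem two_pow_lt_of_lt_numStages (hε : 0 < ε) (hk : k < numStages f g L x₀ ε) :
    2 ^ k < ‖proxGrad f g (1 / L) x₀‖ / ε := by
  have h0 := norm_proxGrad_pos_of_numStages hk
  have h1 := Nat.lt_ceil.1 hk
  rw [Real.lt_logb_iff_rpow_lt one_lt_two (by positivity), Real.rpow_natCast] at h1
  exact h1

theorem norm_proxGrad_div_le (hε : 0 < ε) :
    ‖proxGrad f g (1 / L) x₀‖ / 2 ^ numStages f g L x₀ ε ≤ ε := by
  rcases (norm_nonneg (proxGrad f g (1 / L) x₀)).eq_or_lt with h | h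
  · rw [← h, zero_div]
    exact hε.le
  · have h1 : Real.logb 2 (‖proxGrad f g (1 / L) x₀‖ / ε) ≤ numStages f g L x₀ ε := Nat.le_ceil _
    rw [Real.logb_le_iff_le_rpow one_lt_two (by positivity), Real.rpow_natCast,
      div_le_iff₀ hε] at h1
    rw [div_le_iff₀ (by positivity)]
    linarith

end NumStages

/-! ### Summation of the costs -/

/-- The price of replacing `Γ X` by `X` in a cycle cost. -/
noncomputable def costFactor (Γ : ℝ) : ℝ := √Γ * (1 + Real.log Γ / Real.log 2)

theorem costFactor_nonneg {Γ : ℝ} (hΓ : 1 ≤ Γ) : 0 ≤ costFactor Γ := by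
  have h1 : 0 ≤ Real.log Γ := Real.log_nonneg hΓ
  have h2 : 0 < Real.log 2 := Real.log_pos one_lt_two
  unfold costFactor
  positivity

theorem half_le_log_two_add {X : ℝ} (hX : 0 ≤ X) : 1 / 2 ≤ Real.log (2 + X) := by
  have h1 := Real.log_two_gt_d9
  have h2 : Real.log 2 ≤ Real.log (2 + X) := Real.log_le_log two_pos (by linarith)
  linarith

theorem log_two_add_mul_le {Γ X Y : ℝ} (hΓ : 1 ≤ Γ) (hX : 0 ≤ X) (hXY : X ≤ Y) :
    Real.log (2 + Γ * X) ≤ (1 + Real.log Γ / Real.log 2) * Real.log (2 + Y) := by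
  have h1 : 0 ≤ Real.log Γ := Real.log_nonneg hΓ
  have h2 : 0 < Real.log 2 := Real.log_pos one_lt_two
  have h3 : Real.log 2 ≤ Real.log (2 + Y) := Real.log_le_log two_pos (by linarith)
  calc Real.log (2 + Γ * X) ≤ Real.log (Γ * (2 + Y)) :=
        Real.log_le_log (by positivity) (by nlinarith)
    _ = Real.log Γ / Real.log 2 * Real.log 2 + Real.log (2 + Y) := by
        rw [Real.log_mul (by positivity) (by linarith), div_mul_cancel₀ _ h2.ne']
    _ ≤ Real.log Γ / Real.log 2 * Real.log (2 + Y) + Real.log (2 + Y) := by gcongr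
    _ = _ := by ring

theorem cycleCost_mul_le {Γ X Y : ℝ} (hΓ : 1 ≤ Γ) (hX : 0 ≤ X) (hXY : X ≤ Y) :
    cycleCost (Γ * X) ≤ 120 + 120 * costFactor Γ * Real.log (2 + Y) * √X := by
  have h1 := mul_le_mul_of_nonneg_left (log_two_add_mul_le hΓ hX hXY) (Real.sqrt_nonneg (Γ * X))
  rw [Real.sqrt_mul (by linarith)] at h1
  unfold cycleCost costFactor
  rw [Real.sqrt_mul (by linarith)]
  linarith

theorem cycleCost_mul_le_of_one_le {Γ X : ℝ} (hΓ : 1 ≤ Γ) (hX : 0 ≤ X) (h : 1 ≤ Γ * X) :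
    cycleCost (Γ * X) ≤ 360 * costFactor Γ * Real.log (2 + X) * √X := by
  have h1 := cycleCost_mul_le hΓ hX le_rfl
  have h2 : 1 ≤ √Γ * √X := by
    rw [← Real.sqrt_mul (by linarith)]
    exact Real.one_le_sqrt.2 h
  have h3 : 1 ≤ 2 * ((1 + Real.log Γ / Real.log 2) * Real.log (2 + X)) := by
    have h4 := half_le_log_two_add hX
    have h5 : 0 ≤ Real.log Γ / Real.log 2 :=
      div_nonneg (Real.log_nonneg hΓ) (Real.log_nonneg one_le_two)
    nlinarith
  have h4 := mul_le_mul h2 h3 zero_le_one (by positivity)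
  unfold costFactor at *
  linarith

/-- The sum of `τ_k ^ (-p/2)` over the tolerances `τ_k = τ₀ / 2 ^ k ≥ ε` is dominated by its last
term if `p > 0`, and counts the stages if `p = 0`. -/
theorem exists_sum_tolerance_le {p : ℝ} (hp : 0 ≤ p) :
    ∃ S : ℝ, 0 ≤ S ∧ ∀ (τ₀ ε : ℝ) (K : ℕ), 0 < ε → 0 ≤ τ₀ → (∀ k < K, 2 ^ k < τ₀ / ε) →
      ∑ k ∈ Finset.range K, 1 / (τ₀ / 2 ^ k) ^ (p / 2)
        ≤ S * max (1 / ε ^ (p / 2)) (Real.log (τ₀ / ε)) := by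
  rcases hp.eq_or_lt with rfl | hp
  · refine ⟨3, by norm_num, fun τ₀ ε K hε hτ₀ hK => ?_⟩
    simp only [zero_div, Real.rpow_zero, div_one, Finset.sum_const, Finset.card_range,
      nsmul_eq_mul, mul_one]
    rcases K with _ | K
    · have := le_max_left 1 (Real.log (τ₀ / ε))
      push_cast
      linarith
    · have h1 := Real.log_le_log (by positivity) (hK K (by omega)).le
      rw [Real.log_pow] at h1
      have h2 := Real.log_two_gt_d9
      have h3 := le_max_left 1 (Real.log (τ₀ / ε))
      have h4 := le_max_right 1 (Real.log (τ₀ / ε))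
      have h5 : (0 : ℝ) ≤ K := Nat.cast_nonneg K
      push_cast
      nlinarith
  · have hb : 1 < (2 : ℝ) ^ (p / 2) := Real.one_lt_rpow one_lt_two (by linarith)
    set b := (2 : ℝ) ^ (p / 2) with hbdef
    have hb1 : 0 < b - 1 := by linarith
    refine ⟨b / (b - 1), by positivity, fun τ₀ ε K hε hτ₀ hK => ?_⟩
    have hmax : b / (b - 1) * (1 / ε ^ (p / 2))
        ≤ b / (b - 1) * max (1 / ε ^ (p / 2)) (Real.log (τ₀ / ε)) := by
      gcongr
      exact le_max_left _ _
    refine le_trans ?_ hmax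
    rcases K with _ | K
    · rw [Finset.range_zero, Finset.sum_empty]
      positivity
    · have hKlt := hK K (by omega)
      have hτpos : 0 < τ₀ := by
        have h1 : 0 < τ₀ / ε := lt_trans (by positivity) hKlt
        by_contra! h2
        exact absurd h1 (not_lt.2 (div_nonpos_of_nonpos_of_nonneg h2 hε.le))
      have h2 : ∀ k : ℕ, ((2 : ℝ) ^ k) ^ (p / 2) = b ^ k := fun k => by
        rw [hbdef, ← Real.rpow_natCast, ← Real.rpow_mul two_pos.le, ← Real.rpow_natCast,
          ← Real.rpow_mul two_pos.le, mul_comm]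
      have hterm : ∀ k ∈ Finset.range (K + 1),
          1 / (τ₀ / 2 ^ k) ^ (p / 2) = 1 / τ₀ ^ (p / 2) * b ^ k := by
        intro k _
        rw [Real.div_rpow hτpos.le (by positivity), h2, one_div_div]
        ring
      have h3 : b ^ K ≤ (τ₀ / ε) ^ (p / 2) := by
        rw [← h2]
        gcongr
      rw [Real.div_rpow hτpos.le hε.le] at h3
      rw [Finset.sum_congr rfl hterm, ← Finset.mul_sum, geom_sum_eq hb.ne']
      calc 1 / τ₀ ^ (p / 2) * ((b ^ (K + 1) - 1) / (b - 1))
          ≤ 1 / τ₀ ^ (p / 2) * (b * b ^ K / (b - 1)) := by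
            gcongr
            rw [pow_succ]
            linarith
        _ ≤ 1 / τ₀ ^ (p / 2) * (b * (τ₀ ^ (p / 2) / ε ^ (p / 2)) / (b - 1)) := by gcongr
        _ = b / (b - 1) * (1 / ε ^ (p / 2)) := by
            have : 0 < τ₀ ^ (p / 2) := by positivity
            field_simp

/-! ### The complexity bounds -/

section Complexity

variable {f : EuclideanSpace ℝ (Fin d) → ℝ} {g : EuclideanSpace ℝ (Fin d) → EReal}
  {L θ γ ξ c c₀ ε τ : ℝ} {k : ℕ} {x₀ z : EuclideanSpace ℝ (Fin d)}

/-- The standing assumptions of the complexity estimate. -/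
structure IsAdaAGCInput (f : EuclideanSpace ℝ (Fin d) → ℝ)
    (g : EuclideanSpace ℝ (Fin d) → EReal) (L θ γ ξ c c₀ ε : ℝ)
    (x₀ : EuclideanSpace ℝ (Fin d)) : Prop where
  composite : IsComposite f g L
  errorBound : HolderErrorBound (objective f g) ξ θ c
  exponent_pos : 0 < θ
  one_lt : 1 < γ
  start_ne_top : g x₀ ≠ ⊤
  start_gap : ∀ p ∈ optSet (objective f g),
    regObjective f g 0 x₀ x₀ - regObjective f g 0 x₀ p ≤ ξ
  guess_pos : 0 < c₀
  guess_le : c₀ ≤ c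
  accuracy_pos : 0 < ε

theorem IsAdaAGCInput.const_pos (h : IsAdaAGCInput f g L θ γ ξ c c₀ ε x₀) : 0 < c :=
  h.guess_pos.trans_le h.guess_le

theorem IsAdaAGCInput.norm_sq_le (h : IsAdaAGCInput f g L θ γ ξ c c₀ ε x₀) :
    ‖proxGrad f g (1 / L) x₀‖ ^ 2 ≤ 2 * L * ξ := by
  have hc := h.composite
  obtain ⟨p, hp⟩ := hc.exists_min
  have h1 := hc.norm_proxGrad_sq_le x₀ h.start_ne_top
  have h2 := hc.le_of_mem_optSet hp x₀ (hc.isSubgradient_proxStep x₀).1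
  have h3 := h.start_gap p hp
  have h4 := hc.pos
  refine h1.trans ?_
  gcongr
  linarith

theorem IsAdaAGCInput.gap_nonneg (h : IsAdaAGCInput f g L θ γ ξ c c₀ ε x₀) : 0 ≤ ξ := by
  have h1 := h.norm_sq_le
  have h2 := h.composite.pos
  by_contra! h3
  nlinarith [sq_nonneg ‖proxGrad f g (1 / L) x₀‖]

theorem IsAdaAGCInput.gap_pos (h : IsAdaAGCInput f g L θ γ ξ c c₀ ε x₀)
    (hk : k < numStages f g L x₀ ε) : 0 < ξ := by
  have h1 := h.norm_sq_le
  have h2 := h.composite.pos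
  have h3 := norm_proxGrad_pos_of_numStages hk
  by_contra! h4
  nlinarith

theorem IsAdaAGCInput.center_gap (h : IsAdaAGCInput f g L θ γ ξ c c₀ ε x₀)
    (hF : regObjective f g 0 x₀ z ≤ regObjective f g 0 x₀ x₀) (p : EuclideanSpace ℝ (Fin d))
    (hp : p ∈ optSet (objective f g)) :
    regObjective f g 0 z z - regObjective f g 0 z p ≤ ξ := by
  rw [regObjective_zero_center z x₀, regObjective_zero_center z x₀]
  linarith [h.start_gap p hp]

theorem IsAdaAGCInput.logb_nonneg (h : IsAdaAGCInput f g L θ γ ξ c c₀ ε x₀) :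
    0 ≤ Real.logb γ (c / c₀) :=
  Real.logb_nonneg h.one_lt ((one_le_div h.guess_pos).2 h.guess_le)

/-- The total cost in terms of bounds `W k` for the completed cycles and `B` for the cycles given
up. For a fast stage `W k ≥ 8` is enough, and `B` is not involved because no cycle of it is given up. -/
theorem IsAdaAGCInput.exists_run (h : IsAdaAGCInput f g L θ γ ξ c c₀ ε x₀) {W : ℕ → ℝ} {B : ℝ}
    (hB : 0 ≤ B)
    (hW : ∀ k < numStages f g L x₀ ε, ∀ τ, τ = ‖proxGrad f g (1 / L) x₀‖ / 2 ^ k →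
      0 < τ → ε ≤ τ → 0 < ξ →
      (8 ≤ W k ∧ ∀ D Δ, 0 ≤ Δ → Δ ≤ ξ → Δ ≤ 2 * τ * D → D ≤ c * Δ ^ θ → D ≤ τ / L) ∨
      (cycleCost (L * errorFactor θ ξ τ (γ * c)) ≤ W k ∧
        cycleCost (L * errorFactor θ ξ τ (γ * c)) ≤ B)) :
    ∃ N : ℕ, (run f g L θ γ ξ c₀ x₀ N).stage = numStages f g L x₀ ε ∧
      ‖proxGrad f g (1 / L) (run f g L θ γ ξ c₀ x₀ N).center‖ ≤ ε ∧
      (N : ℝ) ≤ ∑ k ∈ Finset.range (numStages f g L x₀ ε), W k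
        + B * (1 + Real.logb γ (c / c₀)) := by
  have hε := h.accuracy_pos
  obtain ⟨N, h1, h2, h3⟩ := exists_run_stage (f := f) (g := g) (L := L) (θ := θ) (ξ := ξ)
    (K := numStages f g L x₀ ε) (x₀ := x₀) (W := W) (B := B) h.one_lt h.guess_pos h.guess_le hB
    h.start_ne_top (by
      intro k hk z ce hz hF hG hce hceγ
      have hξ := h.gap_pos hk
      have hτ : 0 < ‖proxGrad f g (1 / L) x₀‖ / 2 ^ k := by
        have := norm_proxGrad_pos_of_numStages hk
        positivity
      have hετ : ε ≤ ‖proxGrad f g (1 / L) x₀‖ / 2 ^ k := by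
        have h1 := (lt_div_iff₀ hε).1 (two_pow_lt_of_lt_numStages hε hk)
        rw [le_div_iff₀ (by positivity)]
        linarith
      rcases hW k hk _ rfl hτ hετ hξ with ⟨hWk, hfast⟩ | ⟨hWk, hBk⟩
      · obtain ⟨n, hn, hcomp⟩ := exists_completes_of_fast (γ := γ) (k := k) h.composite
          h.errorBound hξ hτ hce hz (h.center_gap hF) hG hfast
        exact .inl ⟨n, le_trans (by exact_mod_cast hn) hWk, hcomp⟩
      · rcases cycle_outcome (k := k) h.composite h.errorBound h.exponent_pos hξ hτ h.const_pos
          hce hceγ hz (h.center_gap hF) hG with ⟨n, hn, hcomp⟩ | ⟨hlt, n, hn, hgive⟩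
        · exact .inl ⟨n, hn.trans hWk, hcomp⟩
        · exact .inr ⟨hlt, n, hn.trans hBk, hgive⟩)
  exact ⟨N, h1, h2.trans (norm_proxGrad_div_le hε), h3⟩

/-- Exponents up to `1/2`: the cycle costs form a geometric sum dominated by the last stage. -/
theorem exists_complexity_of_le_half {θ γ : ℝ} (hθ0 : 0 < θ) (hθ : θ ≤ 1 / 2) (hγ : 1 < γ) :
    ∃ C : ℝ, 0 < C ∧ ∀ (d : ℕ) (f : EuclideanSpace ℝ (Fin d) → ℝ)
      (g : EuclideanSpace ℝ (Fin d) → EReal) (L c c₀ ξ ε : ℝ) (x₀ : EuclideanSpace ℝ (Fin d)),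
      IsAdaAGCInput f g L θ γ ξ c c₀ ε x₀ →
      ∃ N : ℕ, (run f g L θ γ ξ c₀ x₀ N).stage = numStages f g L x₀ ε ∧
        ‖proxGrad f g (1 / L) (run f g L θ γ ξ c₀ x₀ N).center‖ ≤ ε ∧
        (N : ℝ) ≤ C * ((1 + Real.logb γ (c / c₀)) *
          Real.log (2 + L * c ^ (1 / (1 - θ)) / ε ^ ((1 - 2 * θ) / (1 - θ))) *
          (√L * c ^ (1 / (2 * (1 - θ))) * max (1 / ε ^ ((1 - 2 * θ) / (1 - θ) / 2))
            (Real.log (‖proxGrad f g (1 / L) x₀‖ / ε))) + numStages f g L x₀ ε) := by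
  have hθ' : 0 < 1 - θ := by linarith
  have hp : 0 ≤ (1 - 2 * θ) / (1 - θ) := div_nonneg (by linarith) hθ'.le
  obtain ⟨S, hS0, hS⟩ := exists_sum_tolerance_le hp
  set p := (1 - 2 * θ) / (1 - θ) with hpdef
  have htwo : 1 ≤ (2 : ℝ) ^ (θ / (1 - θ)) := Real.one_le_rpow one_le_two (by positivity)
  have hγq : 1 ≤ γ ^ (1 / (1 - θ)) := Real.one_le_rpow hγ.le (by positivity)
  set Γ := γ ^ (1 / (1 - θ)) * 2 ^ (θ / (1 - θ)) with hΓdef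
  have hΓ : 1 ≤ Γ := one_le_mul_of_one_le_of_one_le hγq htwo
  have hF := costFactor_nonneg hΓ
  refine ⟨120 + costFactor Γ * (120 * S + 360), by positivity,
    fun d f g L c c₀ ξ ε x₀ h => ?_⟩
  have hL := h.composite.pos
  have hc := h.const_pos
  have hε := h.accuracy_pos
  have hlogb := h.logb_nonneg
  have hX : ∀ τ : ℝ, 0 < τ → √(L * c ^ (1 / (1 - θ)) / τ ^ p)
      = √L * c ^ (1 / (2 * (1 - θ))) * (1 / τ ^ (p / 2)) := by
    intro τ hτ
    rw [Real.sqrt_div (by positivity), Real.sqrt_mul hL.le, Real.sqrt_eq_rpow (c ^ _),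
      Real.sqrt_eq_rpow (τ ^ _), ← Real.rpow_mul hc.le, ← Real.rpow_mul hτ.le, mul_one_div,
      mul_one_div, mul_one_div]
    congr 3
    field_simp
  have hmono : ∀ τ : ℝ, ε ≤ τ → L * c ^ (1 / (1 - θ)) / τ ^ p ≤ L * c ^ (1 / (1 - θ)) / ε ^ p :=
    fun τ hτ => by gcongr
  set Y := L * c ^ (1 / (1 - θ)) / ε ^ p with hY
  have hY0 : 0 < Y := by positivity
  set ℓ := Real.log (2 + Y) with hℓ
  have hℓ0 : 1 / 2 ≤ ℓ := half_le_log_two_add hY0.le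
  set U := √L * c ^ (1 / (2 * (1 - θ))) with hU
  have hU0 : 0 < U := by positivity
  set M := max (1 / ε ^ (p / 2)) (Real.log (‖proxGrad f g (1 / L) x₀‖ / ε)) with hM
  have hM1 : 1 / ε ^ (p / 2) ≤ M := le_max_left _ _
  have hM0 : 0 < M := lt_of_lt_of_le (by positivity) hM1
  set R := 1 + Real.logb γ (c / c₀) with hR
  have hR1 : 1 ≤ R := by linarith
  have hfactor : ∀ τ : ℝ, L * errorFactor θ ξ τ c
      = 2 ^ (θ / (1 - θ)) * (L * c ^ (1 / (1 - θ)) / τ ^ p) := by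
    intro τ
    rw [errorFactor, if_pos hθ]
    ring
  have hfactorγ : ∀ τ : ℝ, L * errorFactor θ ξ τ (γ * c)
      = Γ * (L * c ^ (1 / (1 - θ)) / τ ^ p) := by
    intro τ
    rw [errorFactor, if_pos hθ, Real.mul_rpow (by linarith) hc.le, hΓdef]
    ring
  have hpos : 0 ≤ R * ℓ * (U * M) := by positivity
  have hK0 : (0 : ℝ) ≤ numStages f g L x₀ ε := Nat.cast_nonneg _
  rcases le_or_gt (2 ^ (θ / (1 - θ)) * Y) 1 with hsmall | hlarge
  · obtain ⟨N, h1, h2, h3⟩ := h.exists_run (W := fun _ => 8) (B := 0) le_rfl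
      (fun k hk τ _ hτ hετ hξ => .inl ⟨le_rfl, fun D Δ hΔ hΔξ hΔD hD =>
        le_div_of_errorFactor_le hL hθ0 hξ hτ hc (by
          rw [hfactor]
          exact le_trans (by gcongr; exact hmono τ hετ) hsmall) hΔ hΔξ hΔD hD⟩)
    refine ⟨N, h1, h2, h3.trans ?_⟩
    rw [Finset.sum_const, Finset.card_range, nsmul_eq_mul, zero_mul, add_zero]
    have h4 : 0 ≤ costFactor Γ * (120 * S + 360) := by positivity
    nlinarith [mul_nonneg h4 hpos, mul_nonneg h4 hK0]
  · have hΓY : 1 ≤ Γ * Y := by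
      refine hlarge.le.trans ?_
      rw [hΓdef]
      gcongr
      exact le_mul_of_one_le_left (by positivity) hγq
    obtain ⟨N, h1, h2, h3⟩ := h.exists_run
      (W := fun k => 120 + 120 * costFactor Γ * ℓ *
        (U * (1 / (‖proxGrad f g (1 / L) x₀‖ / 2 ^ k) ^ (p / 2))))
      (B := 360 * costFactor Γ * ℓ * (U * M)) (by positivity)
      (fun k hk τ hτdef hτ hετ hξ => .inr ⟨by
        rw [hfactorγ, ← hτdef, ← hX τ hτ]
        exact cycleCost_mul_le hΓ (by positivity) (hmono τ hετ), by
        rw [hfactorγ]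
        refine (cycleCost_mono (by positivity)
          (mul_le_mul_of_nonneg_left (hmono τ hετ) (by linarith))).trans
          ((cycleCost_mul_le_of_one_le hΓ hY0.le hΓY).trans ?_)
        rw [hX ε hε]
        gcongr⟩)
    refine ⟨N, h1, h2, h3.trans ?_⟩
    have h4 := hS ‖proxGrad f g (1 / L) x₀‖ ε (numStages f g L x₀ ε) hε (norm_nonneg _)
      fun k hk => two_pow_lt_of_lt_numStages hε hk
    rw [Finset.sum_add_distrib, Finset.sum_const, Finset.card_range, nsmul_eq_mul,
      ← Finset.mul_sum, ← Finset.mul_sum]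
    have h5 : 120 * costFactor Γ * ℓ * (U * ∑ k ∈ Finset.range (numStages f g L x₀ ε),
        1 / (‖proxGrad f g (1 / L) x₀‖ / 2 ^ k) ^ (p / 2))
        ≤ 120 * costFactor Γ * ℓ * (U * (S * M)) := by gcongr
    have h6 : 120 * costFactor Γ * ℓ * (U * (S * M)) * 1
        ≤ 120 * costFactor Γ * ℓ * (U * (S * M)) * R := by gcongr
    have h7 : 0 ≤ costFactor Γ * (120 * S + 360) * numStages f g L x₀ ε := by positivity
    linarith

/-- Exponents above `1/2`: only logarithmically many stages are slow. -/
theorem exists_complexity_of_half_lt {θ γ : ℝ} (hθ : 1 / 2 < θ) (hθ1 : θ ≤ 1) (hγ : 1 < γ) :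
    ∃ C : ℝ, 0 < C ∧ ∀ (d : ℕ) (f : EuclideanSpace ℝ (Fin d) → ℝ)
      (g : EuclideanSpace ℝ (Fin d) → EReal) (L c c₀ ξ ε : ℝ) (x₀ : EuclideanSpace ℝ (Fin d)),
      IsAdaAGCInput f g L θ γ ξ c c₀ ε x₀ →
      ∃ N : ℕ, (run f g L θ γ ξ c₀ x₀ N).stage = numStages f g L x₀ ε ∧
        ‖proxGrad f g (1 / L) (run f g L θ γ ξ c₀ x₀ N).center‖ ≤ ε ∧
        (N : ℝ) ≤ C * ((1 + Real.logb γ (c / c₀)) *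
          Real.log (2 + L * c ^ 2 * ξ ^ (2 * θ - 1)) ^ 2 * (√L * c * ξ ^ (θ - 1 / 2))
            + numStages f g L x₀ ε) := by
  have hθ0 : 0 < θ := by linarith
  have hθ' : 0 < 2 * θ - 1 := by linarith
  set Γ := 2 * γ ^ 2 with hΓdef
  have hΓ : 1 ≤ Γ := by nlinarith
  have hF := costFactor_nonneg hΓ
  -- `κ log(2 + X)` bounds the number of slow stages
  set κ := 2 + 6 / (2 * θ - 1) with hκ
  have hκ0 : 0 < κ := by positivity
  refine ⟨8 + 360 * costFactor Γ * (κ + 2), by positivity, fun d f g L c c₀ ξ ε x₀ h => ?_⟩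
  have hL := h.composite.pos
  have hc := h.const_pos
  have hε := h.accuracy_pos
  have hξ0 := h.gap_nonneg
  have hlogb := h.logb_nonneg
  set X := L * c ^ 2 * ξ ^ (2 * θ - 1) with hXdef
  have hX0 : 0 ≤ X := by positivity
  have hsqrtX : √X = √L * c * ξ ^ (θ - 1 / 2) := by
    rw [hXdef, Real.sqrt_mul (by positivity), Real.sqrt_mul hL.le, Real.sqrt_sq hc.le,
      Real.sqrt_eq_rpow (ξ ^ _), ← Real.rpow_mul hξ0]
    congr 2
    ring
  rw [← hsqrtX]
  set ℓ := Real.log (2 + X) with hℓ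
  have hℓ0 : 1 / 2 ≤ ℓ := half_le_log_two_add hX0
  set R := 1 + Real.logb γ (c / c₀) with hR
  have hR1 : 1 ≤ R := by linarith
  have hfactor : ∀ τ : ℝ, L * errorFactor θ ξ τ c = 2 * X := by
    intro τ
    rw [errorFactor, if_neg hθ.not_ge, hXdef]
    ring
  have hfactorγ : ∀ τ : ℝ, L * errorFactor θ ξ τ (γ * c) = Γ * X := by
    intro τ
    rw [errorFactor, if_neg hθ.not_ge, hXdef, hΓdef]
    ring
  have hpos : 0 ≤ R * ℓ ^ 2 * √X := by positivity
  have hK0 : (0 : ℝ) ≤ numStages f g L x₀ ε := Nat.cast_nonneg _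
  rcases le_or_gt (2 * X) 1 with hsmall | hlarge
  · obtain ⟨N, h1, h2, h3⟩ := h.exists_run (W := fun _ => 8) (B := 0) le_rfl
      (fun k hk τ _ hτ hετ hξ => .inl ⟨le_rfl, fun D Δ hΔ hΔξ hΔD hD =>
        le_div_of_errorFactor_le hL hθ0 hξ hτ hc (by rwa [hfactor]) hΔ hΔξ hΔD hD⟩)
    refine ⟨N, h1, h2, h3.trans ?_⟩
    rw [Finset.sum_const, Finset.card_range, nsmul_eq_mul, zero_mul, add_zero]
    have h4 : 0 ≤ 360 * costFactor Γ * (κ + 2) := by positivity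
    nlinarith [mul_nonneg h4 hpos, mul_nonneg h4 hK0]
  · have hXpos : 0 < X := by linarith
    have hΓX : 1 ≤ Γ * X := by
      rw [hΓdef]
      nlinarith
    set B := 360 * costFactor Γ * ℓ * √X with hB
    have hB0 : 0 ≤ B := by positivity
    have hcost : cycleCost (Γ * X) ≤ B := cycleCost_mul_le_of_one_le hΓ hX0 hΓX
    -- the first stage from which on the tolerance is small enough for `le_div_of_rpow_lt`
    set k₀ := ⌊Real.logb 2 (4 * √X) / (2 * θ - 1)⌋₊ + 1 with hk₀
    have hk₀le : (k₀ : ℝ) ≤ κ * ℓ := by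
      have h1 : Real.logb 2 (4 * √X) ≤ 2 + 2 * ℓ := by
        have h2 : 4 * √X ≤ 2 ^ 2 * (2 + X) := by
          nlinarith [Real.sq_sqrt hX0, Real.sqrt_nonneg X, sq_nonneg (√X - 1)]
        have h3 : Real.log (4 * √X) ≤ 2 * Real.log 2 + ℓ := by
          refine (Real.log_le_log (by positivity) h2).trans (le_of_eq ?_)
          rw [Real.log_mul (by norm_num) (by linarith), Real.log_pow]
          norm_num [hℓ]
        have h4 := Real.log_two_gt_d9
        rw [Real.logb, div_le_iff₀ (by linarith)]
        nlinarith
      have h2 : Real.logb 2 (4 * √X) / (2 * θ - 1) ≤ 6 * ℓ / (2 * θ - 1) := by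
        gcongr
        linarith
      have h3 : (⌊Real.logb 2 (4 * √X) / (2 * θ - 1)⌋₊ : ℝ) ≤ 6 * ℓ / (2 * θ - 1) := by
        rcases le_total 0 (Real.logb 2 (4 * √X) / (2 * θ - 1)) with h4 | h4
        · exact (Nat.floor_le h4).trans h2
        · rw [Nat.floor_of_nonpos h4]
          push_cast
          positivity
      have h4 : κ * ℓ = 2 * ℓ + 6 * ℓ / (2 * θ - 1) := by rw [hκ]; ring
      rw [hk₀, h4]
      push_cast
      linarith
    have hfast : ∀ k : ℕ, k₀ ≤ k → 0 < ξ → ∀ τ, 0 < τ →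
        τ = ‖proxGrad f g (1 / L) x₀‖ / 2 ^ k →
        2 * c * L ^ (1 - θ) * τ ^ (2 * θ - 1) < 1 := by
      intro k hk hξ τ hτ hτdef
      have h1 : Real.logb 2 (4 * √X) < k * (2 * θ - 1) := by
        rw [← div_lt_iff₀ hθ']
        refine (Nat.lt_floor_add_one _).trans_le ?_
        have : (k₀ : ℝ) ≤ k := by exact_mod_cast hk
        rw [hk₀] at this
        push_cast at this
        exact this
      rw [Real.logb_lt_iff_lt_rpow one_lt_two (by positivity), Real.rpow_mul two_pos.le,
        Real.rpow_natCast] at h1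
      have h2 : ‖proxGrad f g (1 / L) x₀‖ ^ (2 * θ - 1)
          ≤ 2 * (L ^ (θ - 1 / 2) * ξ ^ (θ - 1 / 2)) := by
        have h3 : ‖proxGrad f g (1 / L) x₀‖ ^ (2 * θ - 1)
            = (‖proxGrad f g (1 / L) x₀‖ ^ 2) ^ (θ - 1 / 2) := by
          rw [← Real.rpow_natCast, ← Real.rpow_mul (norm_nonneg _)]
          congr 1
          push_cast
          ring
        have h4 : (2 : ℝ) ^ (θ - 1 / 2) ≤ 2 := by
          calc (2 : ℝ) ^ (θ - 1 / 2) ≤ 2 ^ (1 : ℝ) :=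
                Real.rpow_le_rpow_of_exponent_le one_le_two (by linarith)
            _ = 2 := Real.rpow_one 2
        rw [h3]
        calc _ ≤ (2 * L * ξ) ^ (θ - 1 / 2) :=
              Real.rpow_le_rpow (sq_nonneg _) h.norm_sq_le (by linarith)
          _ = 2 ^ (θ - 1 / 2) * (L ^ (θ - 1 / 2) * ξ ^ (θ - 1 / 2)) := by
              rw [mul_assoc, Real.mul_rpow two_pos.le (by positivity),
                Real.mul_rpow hL.le hξ.le]
          _ ≤ _ := by gcongr
      have h5 : L ^ (1 - θ) * L ^ (θ - 1 / 2) = √L := by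
        rw [← Real.rpow_add hL, Real.sqrt_eq_rpow]
        congr 1
        ring
      rw [hτdef, Real.div_rpow (norm_nonneg _) (by positivity), mul_div_assoc',
        div_lt_one (by positivity)]
      refine lt_of_le_of_lt ?_ h1
      calc _ ≤ 2 * c * L ^ (1 - θ) * (2 * (L ^ (θ - 1 / 2) * ξ ^ (θ - 1 / 2))) := by gcongr
        _ = 4 * ((L ^ (1 - θ) * L ^ (θ - 1 / 2)) * c * ξ ^ (θ - 1 / 2)) := by ring
        _ = 4 * √X := by rw [h5, hsqrtX]
    obtain ⟨N, h1, h2, h3⟩ := h.exists_run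
      (W := fun k => 8 + if k < k₀ then B else 0) hB0
      (fun k hk τ hτdef hτ hετ hξ => by
        by_cases hkk : k < k₀
        · right
          rw [hfactorγ, if_pos hkk]
          exact ⟨by linarith, hcost⟩
        · left
          rw [if_neg hkk]
          exact ⟨by norm_num, fun D Δ hΔ hΔξ hΔD hD => le_div_of_rpow_lt hL hθ0 hθ1 hτ hc
            (hfast k (not_lt.1 hkk) hξ τ hτ hτdef) hΔ hΔD hD⟩)
    refine ⟨N, h1, h2, h3.trans ?_⟩
    rw [Finset.sum_add_distrib, Finset.sum_const, Finset.card_range, nsmul_eq_mul,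
      ← Finset.sum_filter, Finset.sum_const, nsmul_eq_mul]
    have h4 : (((Finset.range (numStages f g L x₀ ε)).filter (· < k₀)).card : ℝ) ≤ κ * ℓ := by
      refine le_trans ?_ hk₀le
      have h5 : ((Finset.range (numStages f g L x₀ ε)).filter (· < k₀)) ⊆ Finset.range k₀ := by
        intro i hi
        exact Finset.mem_range.2 (Finset.mem_filter.1 hi).2
      have h6 := Finset.card_le_card h5
      rw [Finset.card_range] at h6
      exact_mod_cast h6
    have h5 := mul_le_mul_of_nonneg_right h4 hB0
    have h6 : κ * ℓ * B ≤ κ * ℓ * B * R := le_mul_of_one_le_right (by positivity) hR1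
    have h7 : B * R ≤ 2 * ℓ * (B * R) := le_mul_of_one_le_left (by positivity) (by linarith)
    have h8 : (κ * ℓ + 2 * ℓ) * (B * R) = 360 * costFactor Γ * (κ + 2) * (R * ℓ ^ 2 * √X) := by
      rw [hB]; ring
    have h9 : 0 ≤ 360 * costFactor Γ * (κ + 2) * numStages f g L x₀ ε := by positivity
    linarith

end Complexity

end AdaAGC

theorem mainTheorem1 (θ γ : ℝ) (hθ0 : 0 < θ) (hθ1 : θ ≤ 1) (hγ : 1 < γ) :
    ∃ C : ℝ, 0 < C ∧
      ∀ (d : ℕ) (f : EuclideanSpace ℝ (Fin d) → ℝ) (g : EuclideanSpace ℝ (Fin d) → EReal)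
        (L c c₀ ξ ε : ℝ) (x₀ : EuclideanSpace ℝ (Fin d)),
        0 < L → AdaAGC.IsConvexSmooth f L → AdaAGC.IsProperConvexLsc g →
        (AdaAGC.optSet (AdaAGC.objective f g)).Nonempty →
        AdaAGC.objective f g x₀ - AdaAGC.optValue (AdaAGC.objective f g) ≤ (ξ : EReal) →
        AdaAGC.HolderErrorBound (AdaAGC.objective f g) ξ θ c →
        0 < c₀ → c₀ ≤ c → 0 < ε →
        ∃ N : ℕ,
          (AdaAGC.run f g L θ γ ξ c₀ x₀ N).stage = AdaAGC.numStages f g L x₀ ε ∧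
          ‖AdaAGC.proxGrad f g (1 / L) (AdaAGC.run f g L θ γ ξ c₀ x₀ N).center‖ ≤ ε ∧
          (θ ≤ 1 / 2 →
            (N : ℝ) ≤ C *
              ((1 + Real.logb γ (c / c₀)) *
                  Real.log (2 + L * c ^ (1 / (1 - θ)) / ε ^ ((1 - 2 * θ) / (1 - θ))) *
                  (√L * c ^ (1 / (2 * (1 - θ))) *
                    max (1 / ε ^ ((1 - 2 * θ) / (1 - θ) / 2))
                      (Real.log (‖AdaAGC.proxGrad f g (1 / L) x₀‖ / ε)))
                + AdaAGC.numStages f g L x₀ ε)) ∧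
          (1 / 2 < θ →
            (N : ℝ) ≤ C *
              ((1 + Real.logb γ (c / c₀)) *
                  Real.log (2 + L * c ^ 2 * ξ ^ (2 * θ - 1)) ^ 2 *
                  (√L * c * ξ ^ (θ - 1 / 2))
                + AdaAGC.numStages f g L x₀ ε)) := by
  have hinput : ∀ {d : ℕ} {f : EuclideanSpace ℝ (Fin d) → ℝ}
      {g : EuclideanSpace ℝ (Fin d) → EReal} {L c c₀ ξ ε : ℝ} {x₀ : EuclideanSpace ℝ (Fin d)},
      0 < L → AdaAGC.IsConvexSmooth f L → AdaAGC.IsProperConvexLsc g →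
      (AdaAGC.optSet (AdaAGC.objective f g)).Nonempty →
      AdaAGC.objective f g x₀ - AdaAGC.optValue (AdaAGC.objective f g) ≤ (ξ : EReal) →
      AdaAGC.HolderErrorBound (AdaAGC.objective f g) ξ θ c →
      0 < c₀ → c₀ ≤ c → 0 < ε → AdaAGC.IsAdaAGCInput f g L θ γ ξ c c₀ ε x₀ := by
    intro d f g L c c₀ ξ ε x₀ hL hf hg hΩ hgap hH hc₀ hcc hε
    have hc : AdaAGC.IsComposite f g L := ⟨hL, hf, hg, hΩ⟩
    have hx₀ : g x₀ ≠ ⊤ := by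
      obtain ⟨p, hp⟩ := hΩ
      intro htop
      rw [AdaAGC.optValue_eq hp, AdaAGC.objective_eq_coe hg (hc.ne_top_of_mem_optSet hp) x₀,
        AdaAGC.objective, htop, EReal.coe_add_top, EReal.top_sub_coe, top_le_iff] at hgap
      exact EReal.coe_ne_top ξ hgap
    refine ⟨hc, hH, hθ0, hγ, hx₀, fun p hp => ?_, hc₀, hcc, hε⟩
    rwa [AdaAGC.objective_sub_optValue hc hp hx₀ x₀, EReal.coe_le_coe_iff] at hgap
  rcases le_or_gt θ (1 / 2) with hθ | hθ
  · obtain ⟨C, hC, h⟩ := AdaAGC.exists_complexity_of_le_half hθ0 hθ hγ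
    refine ⟨C, hC, fun d f g L c c₀ ξ ε x₀ hL hf hg hΩ hgap hH hc₀ hcc hε => ?_⟩
    obtain ⟨N, h1, h2, h3⟩ :=
      h d f g L c c₀ ξ ε x₀ (hinput hL hf hg hΩ hgap hH hc₀ hcc hε)
    exact ⟨N, h1, h2, fun _ => h3, fun hlt => absurd hθ hlt.not_ge⟩
  · obtain ⟨C, hC, h⟩ := AdaAGC.exists_complexity_of_half_lt hθ hθ1 hγ
    refine ⟨C, hC, fun d f g L c c₀ ξ ε x₀ hL hf hg hΩ hgap hH hc₀ hcc hε => ?_⟩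
    obtain ⟨N, h1, h2, h3⟩ :=
      h d f g L c c₀ ξ ε x₀ (hinput hL hf hg hΩ hgap hH hc₀ hcc hε)
    exact ⟨N, h1, h2, fun hle => absurd hle hθ.not_ge, fun _ => h3⟩
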